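/- Let $k$ be a field and let $\mathcal B$ be a $k$-linear Krull--Schmidt exact category with enough projectives and enough injectives; let $\mathcal P$ and $\mathcal I$ be its full subcategories of projective and injective objects. All subcategories are full and closed under isomorphisms. The class of short exact sequences $X\rightarrowtail Y\twoheadrightarrow Z$ consists of kernel-cokernel pairs and is stable under isomorphisms, direct sums and direct summands. A pair $(\mathcal U,\mathcal V)$ of subcategories closed under direct summands is a cotorsion pair if $\operatorname{Ext}^1_{\mathcal B}(\mathcal U,\mathcal V)=0$ and every $B\in\mathcal B$ admits short exact sequences $V_B\rightarrowtail U_B\twoheadrightarrow B$ and $B\rightarrowtail V^B\twoheadrightarrow U^B$ with $U_B,U^B\in\mathcal U$ and $V_B,V^B\in\mathcal V$. For subcategories $\mathcal W,\mathcal R$ let $\mathcal W_{\mathcal R}$ be the subcategory of those objects of $\mathcal W$ that have no nonzero direct summand in $\mathcal R$. Let $\Omega\mathcal W$ be the subcategory of objects $A$ with a short exact sequence $A\rightarrowtail P\twoheadrightarrow W$, $P\in\mathcal P$, $W\in\mathcal W$, and $\Sigma\mathcal W$ the subcategory of objects $A$ with a short exact sequence $W\rightarrowtail I\twoheadrightarrow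 A$, $I\in\mathcal I$, $W\in\mathcal W$. Let $(\mathcal C,\mathcal K)$ be a fully rigid cotorsion pair. This means that $(\mathcal C,\mathcal K)$ is a cotorsion pair with $\operatorname{Ext}^1_{\mathcal B}(\mathcal C,\mathcal C)=0$ and $\mathcal C_{\mathcal P}\neq 0$, and that every indecomposable object of $\mathcal B$ lies in $\mathcal K$ or in $\mathcal H$, where $\mathcal H$ is the subcategory of objects $B$ admitting short exact sequences $K_B\rightarrowtail C_B\twoheadrightarrow B$ and $B\rightarrowtail K^B\twoheadrightarrow C^B$ with $K_B\in\mathcal K$, $C^B\in\mathcal C$ and $C_B,K^B\in\mathcal C\cap\mathcal K$. Assume that there is also a cotorsion pair $(\mathcal K,\mathcal D)$. Let $\mathcal B/\mathcal K$ be the category with the objects of $\mathcal B$ whose morphisms are those of $\mathcal B$ modulo the morphisms that factor through an object of $\mathcal K$, and write $\overline f$ for the class of a morphism $f$. For a morphism $x\colon X\to Y$, the morphism $\Omega x\colon\Omega X\to\Omega Y$ is the left-hand component of any morphism of short exact sequences $(\Omega x,p,x)$ from $\Omega X\rightarrowtail P\twoheadrightarrow X$ to $\Omega Y\rightarrowtail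 P'\twoheadrightarrow Y$ with $P,P'\in\mathcal P$. Dually, $\Sigma x\colon\Sigma X\to\Sigma Y$ is the right-hand component of any morphism of short exact sequences $(x,q,\Sigma x)$ from $X\rightarrowtail I\twoheadrightarrow \Sigma X$ to $Y\rightarrowtail I'\twoheadrightarrow\Sigma Y$ with $I,I'\in\mathcal I$. Whether $\overline{\Omega x}=0$ or $\overline{\Sigma x}=0$ does not depend on the choices. Then $\mathcal B/\mathcal K$ is abelian. Moreover, $\mathcal B/\mathcal K$ is $1$-Gorenstein (that is, it has enough projectives and enough injectives, every injective object has projective dimension at most $1$, and every projective object has injective dimension at most $1$) if and only if both of the following hold: (a) for every object $X\in(\Sigma\mathcal D)_{\Omega\mathcal C}\cap\mathcal H_{\mathcal K}$ and every short exact sequence $X\overset{x}{\rightarrowtail}C^1\twoheadrightarrow C^2$ with $C^1,C^2\in\mathcal C$, one has $\overline{\Omega x}=0$; (b) for every object $Y\in(\Omega\mathcal C)_{\Sigma\mathcal D}\cap\mathcal H_{\mathcal K}$ and every short exact sequence $D_2\rightarrowtail D_1\overset{y}{\twoheadrightarrow}Y$ with $D_1,D_2\in\mathcal D$, one has $\overline{\Sigma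 y}=0$. -/

import Mathlib

open CategoryTheory CategoryTheory.Limits

universe v u

namespace ExactCat

/-! ### Exact categories -/

section ExactStructures

attribute [local instance] hasBinaryBiproducts_of_finite_biproducts

variable {B : Type u} [Category.{v} B] [Preadditive B] [HasFiniteBiproducts B]

/-- `A --i--> M --d--> Z` is a short exact sequence of the class `E`. -/
def IsConflation (E : ObjectProperty (ShortComplex B)) {A M Z : B}
    (i : A ⟶ M) (d : M ⟶ Z) : Prop :=
  ∃ w : i ≫ d = 0, E (ShortComplex.mk i d w)

/-- `i` is the first map of a short exact sequence of the class `E`. -/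
def IsInflation (E : ObjectProperty (ShortComplex B)) {A M : B} (i : A ⟶ M) : Prop :=
  ∃ (Z : B) (d : M ⟶ Z), IsConflation E i d

/-- `d` is the second map of a short exact sequence of the class `E`. -/
def IsDeflation (E : ObjectProperty (ShortComplex B)) {M Z : B} (d : M ⟶ Z) : Prop :=
  ∃ (A : B) (i : A ⟶ M), IsConflation E i d

/-- `E` is an exact structure on the additive category `B`: a class of kernel-cokernel pairs,
stable under isomorphisms, direct sums and direct summands, such that identities are inflations
and deflations, inflations and deflations compose, and deflations (inflations) have pullbacks
(pushouts) along arbitrary morphisms, which are again deflations (inflations). -/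
structure IsExactStructure (E : ObjectProperty (ShortComplex B)) : Prop where
  isKernel : ∀ S : ShortComplex B, E S → Nonempty (IsLimit (KernelFork.ofι S.f S.zero))
  isCokernel : ∀ S : ShortComplex B, E S → Nonempty (IsColimit (CokernelCofork.ofπ S.g S.zero))
  of_iso : ∀ {S T : ShortComplex B}, (S ≅ T) → E S → E T
  /-- stability under direct sums and direct summands -/
  biprod_iff : ∀ {A M Z A' M' Z' : B} (i : A ⟶ M) (d : M ⟶ Z) (i' : A' ⟶ M') (d' : M' ⟶ Z'),
    IsConflation E (biprod.map i i') (biprod.map d d') ↔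
      IsConflation E i d ∧ IsConflation E i' d'
  id_inflation : ∀ X : B, IsInflation E (𝟙 X)
  id_deflation : ∀ X : B, IsDeflation E (𝟙 X)
  comp_inflation : ∀ {X Y Z : B} (i : X ⟶ Y) (j : Y ⟶ Z),
    IsInflation E i → IsInflation E j → IsInflation E (i ≫ j)
  comp_deflation : ∀ {X Y Z : B} (p : X ⟶ Y) (q : Y ⟶ Z),
    IsDeflation E p → IsDeflation E q → IsDeflation E (p ≫ q)
  pullback : ∀ {Y Z Z' : B} (d : Y ⟶ Z) (f : Z' ⟶ Z), IsDeflation E d →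
    ∃ (Y' : B) (f' : Y' ⟶ Y) (d' : Y' ⟶ Z'), IsPullback f' d' d f ∧ IsDeflation E d'
  pushout : ∀ {X Y X' : B} (i : X ⟶ Y) (g : X ⟶ X'), IsInflation E i →
    ∃ (Y' : B) (g' : Y ⟶ Y') (i' : X' ⟶ Y'), IsPushout i g g' i' ∧ IsInflation E i'

/-- The projective objects of the exact category `(B, E)`. -/
def projObj (E : ObjectProperty (ShortComplex B)) : ObjectProperty B := fun P =>
  ∀ ⦃M Z : B⦄ (d : M ⟶ Z), IsDeflation E d → ∀ f : P ⟶ Z, ∃ g : P ⟶ M, g ≫ d = f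

/-- The injective objects of the exact category `(B, E)`. -/
def injObj (E : ObjectProperty (ShortComplex B)) : ObjectProperty B := fun I =>
  ∀ ⦃A M : B⦄ (i : A ⟶ M), IsInflation E i → ∀ f : A ⟶ I, ∃ g : M ⟶ I, i ≫ g = f

/-- `(B, E)` has enough projectives. -/
def HasEnoughProj (E : ObjectProperty (ShortComplex B)) : Prop :=
  ∀ X : B, ∃ (P : B) (d : P ⟶ X), projObj E P ∧ IsDeflation E d

/-- `(B, E)` has enough injectives. -/
def HasEnoughInj (E : ObjectProperty (ShortComplex B)) : Prop :=
  ∀ X : B, ∃ (I : B) (i : X ⟶ I), injObj E I ∧ IsInflation E i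

variable (B) in
/-- Every object is a finite direct sum of objects with local endomorphism rings. -/
def IsKrullSchmidt : Prop :=
  ∀ X : B, ∃ (n : ℕ) (Y : Fin n → B), (∀ j, IsLocalRing (End (Y j))) ∧ Nonempty (X ≅ ⨁ Y)

/-! ### Subcategories -/

/-- `W` is closed under direct summands. -/
def ClosedUnderSummands (W : ObjectProperty B) : Prop :=
  ∀ X Y Z : B, Nonempty (X ≅ Y ⊞ Z) → W X → W Y

/-- The objects of `W` without nonzero direct summands in `R` (zero objects of `W` qualify). -/
def withoutSummand (W R : ObjectProperty B) : ObjectProperty B := fun X =>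
  W X ∧ ∀ Y Z : B, Nonempty (X ≅ Y ⊞ Z) → R Y → IsZero Y

/-- `Ext¹(U, V) = 0`: every short exact sequence `V' ↣ M ↠ U'` with `U'` in `U` and `V'` in `V`
splits. -/
def ExtVanish (E : ObjectProperty (ShortComplex B)) (U V : ObjectProperty B) : Prop :=
  ∀ ⦃V' M U' : B⦄ (i : V' ⟶ M) (d : M ⟶ U'), U U' → V V' → IsConflation E i d →
    ∃ s : U' ⟶ M, s ≫ d = 𝟙 U'

/-- Objects `X` with a short exact sequence `X ↣ M ↠ Z`, `M` in `P` and `Z` in `Q`. -/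
def coCone (E : ObjectProperty (ShortComplex B)) (P Q : ObjectProperty B) : ObjectProperty B :=
  fun X => ∃ (M Z : B) (i : X ⟶ M) (d : M ⟶ Z), P M ∧ Q Z ∧ IsConflation E i d

/-- Objects `X` with a short exact sequence `A ↣ M ↠ X`, `A` in `P` and `M` in `Q`. -/
def cone (E : ObjectProperty (ShortComplex B)) (P Q : ObjectProperty B) : ObjectProperty B :=
  fun X => ∃ (A M : B) (i : A ⟶ M) (d : M ⟶ X), P A ∧ Q M ∧ IsConflation E i d

/-- `Ω W`: the syzygies of objects of `W`. -/
def omega (E : ObjectProperty (ShortComplex B)) (W : ObjectProperty B) : ObjectProperty B :=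
  coCone E (projObj E) W

/-- `Σ W`: the cosyzygies of objects of `W`. -/
def sigma (E : ObjectProperty (ShortComplex B)) (W : ObjectProperty B) : ObjectProperty B :=
  cone E W (injObj E)

/-- `(U, V)` is a cotorsion pair. -/
structure IsCotorsionPair (E : ObjectProperty (ShortComplex B)) (U V : ObjectProperty B) :
    Prop where
  left_iso : U.IsClosedUnderIsomorphisms
  right_iso : V.IsClosedUnderIsomorphisms
  left_summands : ClosedUnderSummands U
  right_summands : ClosedUnderSummands V
  ext_vanish : ExtVanish E U V
  /-- every `X` admits `V_X ↣ U_X ↠ X` -/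
  mem_cone : ∀ X : B, cone E V U X
  /-- every `X` admits `X ↣ V^X ↠ U^X` -/
  mem_coCone : ∀ X : B, coCone E V U X

/-- The objects `X` admitting `V_X ↣ U_X ↠ X` and `X ↣ V^X ↠ U^X` with `V_X` in `V`, `U^X` in `U`
and `U_X`, `V^X` in `U ∩ V`. -/
def heartObj (E : ObjectProperty (ShortComplex B)) (U V : ObjectProperty B) : ObjectProperty B :=
  fun X => cone E V (U ⊓ V) X ∧ coCone E (U ⊓ V) U X

/-- The cotorsion pair `(C, K)` is fully rigid. -/
structure IsFullyRigid (E : ObjectProperty (ShortComplex B)) (C K : ObjectProperty B) :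
    Prop where
  cotorsion : IsCotorsionPair E C K
  rigid : ExtVanish E C C
  exists_nonzero : ∃ X : B, withoutSummand C (projObj E) X ∧ ¬ IsZero X
  indecomposable_mem : ∀ X : B, Indecomposable X → K X ∨ heartObj E C K X

/-! ### Ideal quotients -/

/-- Two parallel morphisms are identified if their difference factors through an object
of `W`. -/
def factorRel (W : ObjectProperty B) : HomRel B := fun X Y f g =>
  ∃ (Z : B) (a : X ⟶ Z) (b : Z ⟶ Y), W Z ∧ f - g = a ≫ b

/-- The ideal quotient `B / W`. -/
abbrev IdealQuotient (W : ObjectProperty B) : Type u := Quotient (factorRel W)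

/-- The class of `f` in `B / W` is zero. -/
def IsZeroInQuotient (W : ObjectProperty B) {X Y : B} (f : X ⟶ Y) : Prop :=
  (Quotient.functor (factorRel W)).map f = (Quotient.functor (factorRel W)).map 0

/-! ### The morphisms `Ω x` and `Σ y` -/

/-- `a : A ⟶ A'` represents `Ω x`: there is a morphism of short exact sequences
from `A ↣ P ↠ X` to `A' ↣ P' ↠ Y` with components `a`, `p`, `x`, where `P`, `P'` are
projective. -/
def RepresentsOmega (E : ObjectProperty (ShortComplex B)) {X Y A A' : B}
    (x : X ⟶ Y) (a : A ⟶ A') : Prop :=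
  ∃ (P P' : B) (i : A ⟶ P) (d : P ⟶ X) (i' : A' ⟶ P') (d' : P' ⟶ Y) (p : P ⟶ P'),
    projObj E P ∧ projObj E P' ∧ IsConflation E i d ∧ IsConflation E i' d' ∧
      i ≫ p = a ≫ i' ∧ p ≫ d' = d ≫ x

/-- `b : Z ⟶ Z'` represents `Σ y`: there is a morphism of short exact sequences
from `X ↣ I ↠ Z` to `Y ↣ I' ↠ Z'` with components `y`, `q`, `b`, where `I`, `I'` are
injective. -/
def RepresentsSigma (E : ObjectProperty (ShortComplex B)) {X Y Z Z' : B}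
    (y : X ⟶ Y) (b : Z ⟶ Z') : Prop :=
  ∃ (I I' : B) (i : X ⟶ I) (d : I ⟶ Z) (i' : Y ⟶ I') (d' : I' ⟶ Z') (q : I ⟶ I'),
    injObj E I ∧ injObj E I' ∧ IsConflation E i d ∧ IsConflation E i' d' ∧
      i ≫ q = y ≫ i' ∧ q ≫ d' = d ≫ b

/-- The image of `Ω x` in `B / W` is zero. The morphism `Ω x` is determined up to isomorphism of
syzygies and up to morphisms factoring through projectives; all its representatives are
required to vanish. -/
def OmegaVanishes (E : ObjectProperty (ShortComplex B)) (W : ObjectProperty B) {X Y : B}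
    (x : X ⟶ Y) : Prop :=
  ∀ ⦃A A' : B⦄ (a : A ⟶ A'), RepresentsOmega E x a → IsZeroInQuotient W a

/-- The image of `Σ y` in `B / W` is zero. -/
def SigmaVanishes (E : ObjectProperty (ShortComplex B)) (W : ObjectProperty B) {X Y : B}
    (y : X ⟶ Y) : Prop :=
  ∀ ⦃Z Z' : B⦄ (b : Z ⟶ Z'), RepresentsSigma E y b → IsZeroInQuotient W b

end ExactStructures

/-- An abelian category is `1`-Gorenstein if it has enough projectives and enough injectives,
injectives have projective dimension at most `1`, and projectives have injective dimension at
most `1`. -/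
structure IsOneGorenstein (A : Type u) [Category.{v} A] [Abelian A] : Prop where
  enoughProjectives : EnoughProjectives A
  enoughInjectives : EnoughInjectives A
  projectiveDimension_le : ∀ I : A, Injective I → HasProjectiveDimensionLE I 1
  injectiveDimension_le : ∀ P : A, Projective P → HasInjectiveDimensionLE P 1

end ExactCat

/-! Write `Q` for the quotient functor from `B` to `B / K`. Everything rests on one extension
property: maps into objects of `K` extend along inflations whose cokernel lies in `C`. Embedding `X
↣ K' ↠ C'` and pushing out along `g : X ⟶ Y` therefore gives a cokernel of `Q g`
(`isCoker_pushout`), and objects of `ΩC` become projective generators. If `X ↣ C₁ ↠ C₂` with both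
terms in `C`, then `ΩC₁ ⟶ ΩC₂ ⟶ X ⟶ 0` is a presentation in the quotient
(`isCoker_of_coresolution`). Full rigidity provides such a sequence for every indecomposable outside
`K`, so every object of the quotient is a cokernel of a map into a projective from `ΩC`, and the
quotient is abelian.

The presentation continues to the left as `ΩX ⟶ ΩC₁ ⟶ ΩC₂ ⟶ X ⟶ 0`, with first map `Ωx`, exact at
`ΩC₁` (`exists_factor_omega`). If `Ωx` vanishes, this is a projective resolution of length one.
Conversely, if `X` has projective dimension at most `1`, the kernel of `ΩC₁ ⟶ ΩC₂` is a direct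
summand, and the projection onto it factors through `Ωx` by a map `Ωs` with `s : C₁ ⟶ X`. Since the
composite `X ⟶ C₁ ⟶ X` factors through `K`, it is quasi-regular when `X` has no summand in `K`,
which forces `Ωx` to vanish (`map_omega_eq_zero`).

Indecomposable injectives come from `ΣD`, and those also in `ΩC` are projective, so (a) is exactly
the condition on injectives. Condition (b) is (a) in the opposite category, where `C` and `D` trade
places. Two ingredients of this symmetry are not part of the hypotheses: `D` is contained in `K`
(`le_of_isCotorsionPair`), and indecomposables outside `K` are quotients of objects of `D` by
objects of `D` (`cone_of_isLocalObj`). -/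

namespace ExactCat

/-! ### Twin cotorsion pairs in a self-dual form -/

section TwinCotorsion

open Opposite

variable {B : Type u} [Category.{v} B] [Preadditive B]

/-- `X` is the direct sum of `Y` and `Z`. -/
structure DirectSum (X Y Z : B) where
  i : Y ⟶ X
  p : X ⟶ Y
  j : Z ⟶ X
  q : X ⟶ Z
  i_p : i ≫ p = 𝟙 Y
  j_q : j ≫ q = 𝟙 Z
  total : p ≫ i + q ≫ j = 𝟙 X

namespace DirectSum

attribute [simp] i_p j_q

variable {X Y Z T : B} (s : DirectSum X Y Z)

@[simp]
lemma i_p_assoc (f : Y ⟶ T) : s.i ≫ s.p ≫ f = f := by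
  rw [← Category.assoc, s.i_p, Category.id_comp]

@[simp]
lemma j_q_assoc (f : Z ⟶ T) : s.j ≫ s.q ≫ f = f := by
  rw [← Category.assoc, s.j_q, Category.id_comp]

@[simp]
lemma i_q : s.i ≫ s.q = 0 := by
  have h : s.i ≫ (s.p ≫ s.i + s.q ≫ s.j) ≫ s.q = s.i ≫ s.q := by simp [s.total]
  simpa using h

@[simp]
lemma i_q_assoc (f : Z ⟶ T) : s.i ≫ s.q ≫ f = 0 ≫ f := by
  rw [← Category.assoc, s.i_q]

@[simp]
lemma j_p : s.j ≫ s.p = 0 := by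
  have h : s.j ≫ (s.p ≫ s.i + s.q ≫ s.j) ≫ s.p = s.j ≫ s.p := by simp [s.total]
  simpa using h

@[simp]
lemma j_p_assoc (f : Y ⟶ T) : s.j ≫ s.p ≫ f = 0 ≫ f := by
  rw [← Category.assoc, s.j_p]

def symm : DirectSum X Z Y where
  i := s.j
  p := s.q
  j := s.i
  q := s.p
  i_p := s.j_q
  j_q := s.i_p
  total := by rw [add_comm]; exact s.total

def op : DirectSum (op X) (op Y) (op Z) where
  i := s.p.op
  p := s.i.op
  j := s.q.op
  q := s.j.op
  i_p := by rw [← op_comp, s.i_p, op_id]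
  j_q := by rw [← op_comp, s.j_q, op_id]
  total := by rw [← op_comp, ← op_comp, ← op_add, s.total, op_id]

def unop {X Y Z : Bᵒᵖ} (s : DirectSum X Y Z) : DirectSum X.unop Y.unop Z.unop where
  i := s.p.unop
  p := s.i.unop
  j := s.q.unop
  q := s.j.unop
  i_p := by rw [← unop_comp, s.i_p, unop_id]
  j_q := by rw [← unop_comp, s.j_q, unop_id]
  total := by rw [← unop_comp, ← unop_comp, ← unop_add, s.total, unop_id]

noncomputable def ofIso [HasBinaryBiproducts B] (e : X ≅ Y ⊞ Z) : DirectSum X Y Z where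
  i := biprod.inl ≫ e.inv
  p := e.hom ≫ biprod.fst
  j := biprod.inr ≫ e.inv
  q := e.hom ≫ biprod.snd
  i_p := by simp
  j_q := by simp
  total := by
    have h : e.hom ≫ (biprod.fst ≫ biprod.inl + biprod.snd ≫ biprod.inr) ≫ e.inv = 𝟙 X := by
      rw [biprod.total, Category.id_comp, e.hom_inv_id]
    simpa only [Preadditive.add_comp, Preadditive.comp_add, Category.assoc] using h

noncomputable def toIso [HasBinaryBiproducts B] : X ≅ Y ⊞ Z where
  hom := biprod.lift s.p s.q
  inv := biprod.desc s.i s.j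
  hom_inv_id := by simp [s.total]
  inv_hom_id := by ext <;> simp

end DirectSum

/-- `f` factors through an object of `W`. -/
def FactorsThrough (W : ObjectProperty B) {X Y : B} (f : X ⟶ Y) : Prop :=
  ∃ (Z : B) (a : X ⟶ Z) (b : Z ⟶ Y), W Z ∧ a ≫ b = f

omit [Preadditive B] in
lemma FactorsThrough.op {W : ObjectProperty B} {X Y : B} {f : X ⟶ Y}
    (h : FactorsThrough W f) : FactorsThrough W.op f.op := by
  obtain ⟨Z, a, b, hZ, rfl⟩ := h
  exact ⟨Opposite.op Z, b.op, a.op, hZ, rfl⟩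

omit [Preadditive B] in
lemma FactorsThrough.unop {W : ObjectProperty B} {X Y : Bᵒᵖ} {f : X ⟶ Y}
    (h : FactorsThrough W.op f) : FactorsThrough W f.unop := by
  obtain ⟨Z, a, b, hZ, rfl⟩ := h
  exact ⟨Z.unop, b.unop, a.unop, hZ, rfl⟩

/-- The opposite of a class of short complexes. -/
def opClass (E : ObjectProperty (ShortComplex B)) : ObjectProperty (ShortComplex Bᵒᵖ) :=
  fun S ↦ E S.unop

variable {E : ObjectProperty (ShortComplex B)}

lemma isConflation_opClass {A M Z : Bᵒᵖ} {i : A ⟶ M} {d : M ⟶ Z} :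
    IsConflation (opClass E) i d ↔ IsConflation E d.unop i.unop :=
  ⟨fun ⟨w, h⟩ ↦ ⟨by rw [← unop_comp, w, unop_zero], h⟩,
    fun ⟨w, h⟩ ↦ ⟨congrArg Quiver.Hom.op w, h⟩⟩

lemma IsConflation.op {A M Z : B} {i : A ⟶ M} {d : M ⟶ Z} (h : IsConflation E i d) :
    IsConflation (opClass E) d.op i.op :=
  isConflation_opClass.2 h

lemma IsConflation.unop {A M Z : Bᵒᵖ} {i : A ⟶ M} {d : M ⟶ Z}
    (h : IsConflation (opClass E) i d) : IsConflation E d.unop i.unop :=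
  isConflation_opClass.1 h

lemma IsConflation.zero {A M Z : B} {i : A ⟶ M} {d : M ⟶ Z} (h : IsConflation E i d) :
    i ≫ d = 0 := h.1

lemma IsConflation.zero_assoc {A M Z T : B} {i : A ⟶ M} {d : M ⟶ Z} (h : IsConflation E i d)
    (f : Z ⟶ T) : i ≫ d ≫ f = 0 ≫ f := by
  rw [← Category.assoc, h.zero]

lemma projObj_opClass {X : Bᵒᵖ} : projObj (opClass E) X ↔ injObj E X.unop := by
  constructor
  · rintro h A M i ⟨Z, d, hid⟩ f
    obtain ⟨g, hg⟩ := h i.op ⟨_, _, hid.op⟩ f.op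
    exact ⟨g.unop, congrArg Quiver.Hom.unop hg⟩
  · rintro h M Z d ⟨A, i, hid⟩ f
    obtain ⟨g, hg⟩ := h d.unop ⟨_, _, hid.unop⟩ f.unop
    exact ⟨g.op, congrArg Quiver.Hom.op hg⟩

lemma injObj_opClass {X : Bᵒᵖ} : injObj (opClass E) X ↔ projObj E X.unop := by
  constructor
  · rintro h M Z d ⟨A, i, hid⟩ f
    obtain ⟨g, hg⟩ := h d.op ⟨_, _, hid.op⟩ f.op
    exact ⟨g.unop, congrArg Quiver.Hom.unop hg⟩
  · rintro h A M i ⟨Z, d, hid⟩ f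
    obtain ⟨g, hg⟩ := h i.unop ⟨_, _, hid.unop⟩ f.unop
    exact ⟨g.op, congrArg Quiver.Hom.op hg⟩

lemma coCone_opClass {P R : ObjectProperty B} {X : Bᵒᵖ} :
    coCone (opClass E) P.op R.op X ↔ cone E R P X.unop :=
  ⟨fun ⟨M, Z, _, _, hM, hZ, h⟩ ↦ ⟨Z.unop, M.unop, _, _, hZ, hM, h.unop⟩,
    fun ⟨_, _, _, _, hA, hM, h⟩ ↦ ⟨_, _, _, _, hM, hA, h.op⟩⟩

lemma omega_opClass {W : ObjectProperty B} {X : Bᵒᵖ} :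
    omega (opClass E) W.op X ↔ sigma E W X.unop :=
  ⟨fun ⟨M, Z, _, _, hM, hZ, h⟩ ↦ ⟨Z.unop, M.unop, _, _, hZ, projObj_opClass.1 hM, h.unop⟩,
    fun ⟨_, _, _, _, hA, hM, h⟩ ↦ ⟨_, _, _, _, projObj_opClass.2 hM, hA, h.op⟩⟩

lemma sigma_opClass {W : ObjectProperty B} {X : Bᵒᵖ} :
    sigma (opClass E) W.op X ↔ omega E W X.unop :=
  ⟨fun ⟨A, M, _, _, hA, hM, h⟩ ↦ ⟨M.unop, A.unop, _, _, injObj_opClass.1 hM, hA, h.unop⟩,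
    fun ⟨_, _, _, _, hM, hZ, h⟩ ↦ ⟨_, _, _, _, hZ, injObj_opClass.2 hM, h.op⟩⟩

/-- The consequences, in a form stable under passage to the opposite category, of the existence of
cotorsion pairs `(C, K)` and `(K, D)` in an exact category with enough projectives and
injectives. -/
structure TwinCotorsion (E : ObjectProperty (ShortComplex B)) (C K D : ObjectProperty B) :
    Prop where
  mono : ∀ {A M Z : B} {i : A ⟶ M} {d : M ⟶ Z}, IsConflation E i d → Mono i
  epi : ∀ {A M Z : B} {i : A ⟶ M} {d : M ⟶ Z}, IsConflation E i d → Epi d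
  lift : ∀ {A M Z T : B} {i : A ⟶ M} {d : M ⟶ Z}, IsConflation E i d →
    ∀ f : T ⟶ M, f ≫ d = 0 → ∃ g : T ⟶ A, g ≫ i = f
  desc : ∀ {A M Z T : B} {i : A ⟶ M} {d : M ⟶ Z}, IsConflation E i d →
    ∀ f : M ⟶ T, i ≫ f = 0 → ∃ g : Z ⟶ T, d ≫ g = f
  pushout : ∀ {A M Z A' : B} {i : A ⟶ M} {d : M ⟶ Z}, IsConflation E i d → ∀ g : A ⟶ A',
    ∃ (M' : B) (i' : A' ⟶ M') (d' : M' ⟶ Z) (g' : M ⟶ M'),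
      IsConflation E i' d' ∧ i ≫ g' = g ≫ i' ∧ g' ≫ d' = d
  pullback : ∀ {A M Z Z' : B} {i : A ⟶ M} {d : M ⟶ Z}, IsConflation E i d → ∀ f : Z' ⟶ Z,
    ∃ (M' : B) (i' : A ⟶ M') (d' : M' ⟶ Z') (f' : M' ⟶ M),
      IsConflation E i' d' ∧ f' ≫ d = d' ≫ f ∧ i' ≫ f' = i
  deflation_comp : ∀ {A M S Y Z : B} {i : A ⟶ M} {d : M ⟶ S}, IsConflation E i d →
    ∀ s : DirectSum S Y Z, ∃ (N : B) (n : N ⟶ M), IsConflation E n (d ≫ s.p)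
  inflation_comp : ∀ {A M S Y Z : B} {i : S ⟶ M} {d : M ⟶ A}, IsConflation E i d →
    ∀ s : DirectSum S Y Z, ∃ (N : B) (n : M ⟶ N), IsConflation E (s.i ≫ i) n
  extCK : ∀ {A M Z : B} {i : A ⟶ M} {d : M ⟶ Z}, IsConflation E i d → C Z → K A →
    ∃ r : M ⟶ A, i ≫ r = 𝟙 A
  extKD : ∀ {A M Z : B} {i : A ⟶ M} {d : M ⟶ Z}, IsConflation E i d → K Z → D A →
    ∃ s : Z ⟶ M, s ≫ d = 𝟙 Z
  resC : ∀ X : B, ∃ (A M : B) (i : A ⟶ M) (d : M ⟶ X), K A ∧ C M ∧ IsConflation E i d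
  coresK : ∀ X : B, ∃ (M Z : B) (i : X ⟶ M) (d : M ⟶ Z), K M ∧ C Z ∧ IsConflation E i d
  resK : ∀ X : B, ∃ (A M : B) (i : A ⟶ M) (d : M ⟶ X), D A ∧ K M ∧ IsConflation E i d
  coresD : ∀ X : B, ∃ (M Z : B) (i : X ⟶ M) (d : M ⟶ Z), D M ∧ K Z ∧ IsConflation E i d
  enoughProj : ∀ X : B, ∃ (A P : B) (i : A ⟶ P) (d : P ⟶ X), projObj E P ∧ IsConflation E i d
  enoughInj : ∀ X : B, ∃ (I Z : B) (i : X ⟶ I) (d : I ⟶ Z), injObj E I ∧ IsConflation E i d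
  projObj_C : ∀ {P : B}, projObj E P → C P
  projObj_K : ∀ {P : B}, projObj E P → K P
  injObj_D : ∀ {I : B}, injObj E I → D I
  injObj_K : ∀ {I : B}, injObj E I → K I
  summand_C : ∀ {X Y Z : B}, DirectSum X Y Z → C X → C Y
  summand_D : ∀ {X Y Z : B}, DirectSum X Y Z → D X → D Y
  sum_C : ∀ {X Y Z : B}, DirectSum X Y Z → C Y → C Z → C X
  sum_K : ∀ {X Y Z : B}, DirectSum X Y Z → K Y → K Z → K X
  sum_D : ∀ {X Y Z : B}, DirectSum X Y Z → D Y → D Z → D X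
  retract_K : ∀ {X Y : B} (i : Y ⟶ X) (p : X ⟶ Y), i ≫ p = 𝟙 Y → K X → K Y

/-- Twin cotorsion pairs with `Ext¹(C, C) = 0` and `Ext¹(D, D) = 0`. -/
structure RigidTwinCotorsion (E : ObjectProperty (ShortComplex B)) (C K D : ObjectProperty B) :
    Prop extends TwinCotorsion E C K D where
  C_K : ∀ {X : B}, C X → K X
  D_K : ∀ {X : B}, D X → K X

namespace TwinCotorsion

variable {C K D : ObjectProperty B}

/-- Passage to the opposite category exchanges the two outer subcategories. -/
lemma op (h : TwinCotorsion E C K D) : TwinCotorsion (opClass E) D.op K.op C.op where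
  mono {_ _ _ i _} hid := by have := h.epi hid.unop; exact op_mono_of_epi i.unop
  epi {_ _ _ _ d} hid := by have := h.mono hid.unop; exact op_epi_of_mono d.unop
  lift hid f hf := by
    obtain ⟨g, hg⟩ := h.desc hid.unop f.unop (congrArg Quiver.Hom.unop hf)
    exact ⟨g.op, congrArg Quiver.Hom.op hg⟩
  desc hid f hf := by
    obtain ⟨g, hg⟩ := h.lift hid.unop f.unop (congrArg Quiver.Hom.unop hf)
    exact ⟨g.op, congrArg Quiver.Hom.op hg⟩
  pushout hid g := by
    obtain ⟨M', i', d', g', h1, h2, h3⟩ := h.pullback hid.unop g.unop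
    exact ⟨Opposite.op M', d'.op, i'.op, g'.op, h1.op, congrArg Quiver.Hom.op h2,
      congrArg Quiver.Hom.op h3⟩
  pullback hid g := by
    obtain ⟨M', i', d', g', h1, h2, h3⟩ := h.pushout hid.unop g.unop
    exact ⟨Opposite.op M', d'.op, i'.op, g'.op, h1.op, congrArg Quiver.Hom.op h2,
      congrArg Quiver.Hom.op h3⟩
  deflation_comp hid s := by
    obtain ⟨N, n, hn⟩ := h.inflation_comp hid.unop s.unop
    exact ⟨_, n.op, hn.op⟩
  inflation_comp hid s := by
    obtain ⟨N, n, hn⟩ := h.deflation_comp hid.unop s.unop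
    exact ⟨_, n.op, hn.op⟩
  extCK hid hZ hA := by
    obtain ⟨r, hr⟩ := h.extKD hid.unop hA hZ
    exact ⟨r.op, congrArg Quiver.Hom.op hr⟩
  extKD hid hZ hA := by
    obtain ⟨r, hr⟩ := h.extCK hid.unop hA hZ
    exact ⟨r.op, congrArg Quiver.Hom.op hr⟩
  resC X := by
    obtain ⟨M, Z, i, d, hM, hZ, hid⟩ := h.coresD X.unop
    exact ⟨_, _, _, _, hZ, hM, hid.op⟩
  coresK X := by
    obtain ⟨M, Z, i, d, hM, hZ, hid⟩ := h.resK X.unop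
    exact ⟨_, _, _, _, hZ, hM, hid.op⟩
  resK X := by
    obtain ⟨M, Z, i, d, hM, hZ, hid⟩ := h.coresK X.unop
    exact ⟨_, _, _, _, hZ, hM, hid.op⟩
  coresD X := by
    obtain ⟨M, Z, i, d, hM, hZ, hid⟩ := h.resC X.unop
    exact ⟨_, _, _, _, hZ, hM, hid.op⟩
  enoughProj X := by
    obtain ⟨I, Z, i, d, hI, hid⟩ := h.enoughInj X.unop
    exact ⟨_, _, _, _, projObj_opClass.2 hI, hid.op⟩
  enoughInj X := by
    obtain ⟨I, Z, i, d, hI, hid⟩ := h.enoughProj X.unop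
    exact ⟨_, _, _, _, injObj_opClass.2 hI, hid.op⟩
  projObj_C hP := h.injObj_D (projObj_opClass.1 hP)
  projObj_K hP := h.injObj_K (projObj_opClass.1 hP)
  injObj_D hP := h.projObj_C (injObj_opClass.1 hP)
  injObj_K hP := h.projObj_K (injObj_opClass.1 hP)
  summand_C s hX := h.summand_D s.unop hX
  summand_D s hX := h.summand_C s.unop hX
  sum_C s hY hZ := h.sum_D s.unop hY hZ
  sum_K s hY hZ := h.sum_K s.unop hY hZ
  sum_D s hY hZ := h.sum_C s.unop hY hZ
  retract_K i p hip hX := h.retract_K p.unop i.unop (congrArg Quiver.Hom.unop hip) hX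

variable (h : TwinCotorsion E C K D) {A M Z T : B} {i : A ⟶ M} {d : M ⟶ Z}
  (hid : IsConflation E i d)

include h hid

lemma directSum_of_retraction {r : M ⟶ A} (hr : i ≫ r = 𝟙 A) :
    ∃ s : DirectSum M A Z, s.i = i ∧ s.q = d := by
  obtain ⟨s, hs⟩ := h.desc hid (𝟙 M - r ≫ i) (by simp [reassoc_of% hr])
  have := h.epi hid
  exact ⟨⟨i, r, s, d, hr, by rw [← cancel_epi d, reassoc_of% hs]; simp [hid.zero],
    by simp [hs]⟩, rfl, rfl⟩

lemma directSum_of_section {s : Z ⟶ M} (hs : s ≫ d = 𝟙 Z) :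
    ∃ t : DirectSum M A Z, t.i = i ∧ t.q = d := by
  obtain ⟨r, hr⟩ := h.lift hid (𝟙 M - d ≫ s) (by simp [hs])
  have := h.mono hid
  exact ⟨⟨i, r, s, d, by rw [← cancel_mono i, Category.assoc, hr]; simp [hid.zero_assoc], hs,
    by simp [hr]⟩, rfl, rfl⟩

/-- The universal property of a pushout square between conflations. -/
lemma pushout_desc {A' M' : B} {i' : A' ⟶ M'} {d' : M' ⟶ Z} (hid' : IsConflation E i' d')
    {g : A ⟶ A'} {g' : M ⟶ M'} (h1 : i ≫ g' = g ≫ i') (h2 : g' ≫ d' = d)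
    (u : A' ⟶ T) (w : M ⟶ T) (huw : g ≫ u = i ≫ w) :
    ∃ t : M' ⟶ T, i' ≫ t = u ∧ g' ≫ t = w := by
  -- Push out once more, along `u`. The maps `g' ≫ u'` and `w ≫ i''` agree on `A`, so their
  -- difference descends to a section `s` of `d''`. The resulting retraction `t.p` extends `u` over
  -- `M'`; its error on `M` vanishes on `A`, hence comes from a map `z` out of `Z`, which is added
  -- back along `d'`.
  obtain ⟨M'', i'', d'', u', hid'', h3, h4⟩ := h.pushout hid' u
  obtain ⟨s, hs⟩ := h.desc hid (g' ≫ u' - w ≫ i'')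
    (by simp [reassoc_of% h1, h3, reassoc_of% huw])
  have := h.epi hid
  obtain ⟨t, ht1, ht2⟩ := h.directSum_of_section hid'' (s := s) (by
    rw [← cancel_epi d, reassoc_of% hs]
    simp [h4, h2, hid''.zero])
  have e1 : i' ≫ u' ≫ t.p = u := by rw [reassoc_of% h3, ← ht1, t.i_p, Category.comp_id]
  obtain ⟨z, hz⟩ := h.desc hid (w - g' ≫ u' ≫ t.p)
    (by simp [reassoc_of% h1, e1, huw])
  exact ⟨u' ≫ t.p + d' ≫ z, by simp [e1, hid'.zero_assoc], by simp [reassoc_of% h2, hz]⟩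

/-- The pushout of the conflation along `f` starts in `K` and ends in `C`, so it splits. -/
lemma extend_CK (hZ : C Z) (hT : K T) (f : A ⟶ T) : ∃ g : M ⟶ T, i ≫ g = f := by
  obtain ⟨M', i', d', f', hid', h1, -⟩ := h.pushout hid f
  obtain ⟨r, hr⟩ := h.extCK hid' hZ hT
  exact ⟨f' ≫ r, by rw [reassoc_of% h1, hr, Category.comp_id]⟩

lemma extend_KD (hZ : K Z) (hT : D T) (f : A ⟶ T) : ∃ g : M ⟶ T, i ≫ g = f := by
  obtain ⟨M', i', d', f', hid', h1, -⟩ := h.pushout hid f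
  obtain ⟨r, hr⟩ := h.extKD hid' hZ hT
  obtain ⟨t, ht1, -⟩ := h.directSum_of_section hid' hr
  exact ⟨f' ≫ t.p, by rw [reassoc_of% h1, ← ht1, t.i_p, Category.comp_id]⟩

lemma lift_KD (hA : D A) (hT : K T) (f : T ⟶ Z) : ∃ g : T ⟶ M, g ≫ d = f := by
  obtain ⟨g, hg⟩ := h.op.extend_CK hid.op hA hT f.op
  exact ⟨g.unop, congrArg Quiver.Hom.unop hg⟩

omit h in
lemma lift_proj (hT : projObj E T) (f : T ⟶ Z) : ∃ g : T ⟶ M, g ≫ d = f :=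
  hT d ⟨_, _, hid⟩ f

/-- The universal property of a pullback square between conflations. -/
lemma pullback_lift {Z' M' : B} {i' : A ⟶ M'} {d' : M' ⟶ Z'} (hid' : IsConflation E i' d')
    {g : Z' ⟶ Z} {g' : M' ⟶ M} (h1 : g' ≫ d = d' ≫ g) (h2 : i' ≫ g' = i)
    (u : T ⟶ Z') (w : T ⟶ M) (huw : u ≫ g = w ≫ d) :
    ∃ t : T ⟶ M', t ≫ d' = u ∧ t ≫ g' = w := by
  obtain ⟨t, ht1, ht2⟩ := h.op.pushout_desc hid.op hid'.op (congrArg Quiver.Hom.op h1)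
    (congrArg Quiver.Hom.op h2) u.op w.op (congrArg Quiver.Hom.op huw)
  exact ⟨t.unop, congrArg Quiver.Hom.unop ht1, congrArg Quiver.Hom.unop ht2⟩

/-- Conflations with outer terms in `D` pass to direct summands of the quotient. -/
lemma exists_conflation_of_directSum (hA : D A) (hM : D M) {Y W : B} (s : DirectSum Z Y W) :
    ∃ (N : B) (n : N ⟶ M), D N ∧ IsConflation E n (d ≫ s.p) := by
  obtain ⟨N, n, hn⟩ := h.deflation_comp hid s
  refine ⟨N, n, ?_, hn⟩
  -- `N` is shown to be a direct summand of `V`. The inclusion `n` extends to `n' : V ⟶ M`, which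
  -- need not land in `N`; its image in `Y` factors through `K'` and lifts to `w : K' ⟶ M`.
  -- Subtracting `b ≫ w` corrects `n'` without changing it on `N`.
  obtain ⟨V, K', a, b, hV, hK', hab⟩ := h.coresD N
  obtain ⟨n', hn'⟩ := h.extend_KD hab hK' hM n
  obtain ⟨φ, hφ⟩ := h.desc hab (n' ≫ d ≫ s.p) (by rw [reassoc_of% hn', hn.zero])
  obtain ⟨w, hw⟩ := h.lift_KD hid hA hK' (φ ≫ s.i)
  obtain ⟨r, hr⟩ := h.lift hn (n' - b ≫ w) (by simp [reassoc_of% hw, hφ])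
  have := h.mono hn
  obtain ⟨t, -, -⟩ := h.directSum_of_retraction hab (r := r) (by
    rw [← cancel_mono n, Category.assoc, hr]
    simp [hn', hab.zero_assoc])
  exact h.summand_D t hV

end TwinCotorsion

lemma RigidTwinCotorsion.op {C K D : ObjectProperty B} (h : RigidTwinCotorsion E C K D) :
    RigidTwinCotorsion (opClass E) D.op K.op C.op where
  toTwinCotorsion := h.toTwinCotorsion.op
  C_K hX := h.D_K hX
  D_K hX := h.C_K hX

lemma RigidTwinCotorsion.K_of_isZero {C K D : ObjectProperty B}
    (h : RigidTwinCotorsion E C K D) {X : B} (hX : IsZero X) :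
    K X := by
  obtain ⟨Z, -, -, -, hZ, -⟩ := h.coresK X
  exact h.retract_K (0 : X ⟶ Z) 0 (hX.eq_of_src _ _) hZ

lemma RigidTwinCotorsion.C_of_isZero {C K D : ObjectProperty B}
    (h : RigidTwinCotorsion E C K D) {X : B} (hX : IsZero X) :
    C X :=
  h.projObj_C fun _ _ _ _ _ ↦ ⟨0, hX.eq_of_src _ _⟩

end TwinCotorsion

/-! ### Kernels, cokernels and a criterion for normality -/

section ElementaryCokernels

variable {A : Type*} [Category* A] [Preadditive A]

/-- `p` is a cokernel of `f`. -/
structure IsCoker {X Y W : A} (f : X ⟶ Y) (p : Y ⟶ W) : Prop where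
  epi : Epi p
  zero : f ≫ p = 0
  desc : ∀ {T : A} (t : Y ⟶ T), f ≫ t = 0 → ∃ u : W ⟶ T, p ≫ u = t

/-- `k` is a kernel of `f`. -/
structure IsKer {W X Y : A} (k : W ⟶ X) (f : X ⟶ Y) : Prop where
  mono : Mono k
  zero : k ≫ f = 0
  lift : ∀ {T : A} (t : T ⟶ X), t ≫ f = 0 → ∃ u : T ⟶ W, u ≫ k = t

lemma IsCoker.unop {X Y W : Aᵒᵖ} {f : X ⟶ Y} {p : Y ⟶ W} (h : IsCoker f p) :
    IsKer p.unop f.unop where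
  mono := by have := h.epi; exact unop_mono_of_epi p
  zero := congrArg Quiver.Hom.unop h.zero
  lift t ht := by
    obtain ⟨u, hu⟩ := h.desc t.op (congrArg Quiver.Hom.op ht)
    exact ⟨u.unop, congrArg Quiver.Hom.unop hu⟩

noncomputable def IsCoker.isColimit {X Y W : A} {f : X ⟶ Y} {p : Y ⟶ W} (h : IsCoker f p) :
    IsColimit (CokernelCofork.ofπ p h.zero) :=
  have := h.epi
  CokernelCofork.IsColimit.ofπ' p h.zero fun k hk ↦ ⟨(h.desc k hk).choose, (h.desc k hk).choose_spec⟩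

noncomputable def IsKer.isLimit {W X Y : A} {k : W ⟶ X} {f : X ⟶ Y} (h : IsKer k f) :
    IsLimit (KernelFork.ofι k h.zero) :=
  have := h.mono
  KernelFork.IsLimit.ofι' k h.zero fun t ht ↦ ⟨(h.lift t ht).choose, (h.lift t ht).choose_spec⟩

lemma IsCoker.exists_iso {X Y W W' : A} {f : X ⟶ Y} {p : Y ⟶ W} {p' : Y ⟶ W'}
    (h : IsCoker f p) (h' : IsCoker f p') : ∃ e : W ≅ W', p ≫ e.hom = p' := by
  obtain ⟨u, hu⟩ := h.desc p' h'.zero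
  obtain ⟨u', hu'⟩ := h'.desc p h.zero
  have := h.epi
  have := h'.epi
  exact ⟨⟨u, u', by rw [← cancel_epi p, reassoc_of% hu, hu', Category.comp_id],
    by rw [← cancel_epi p', reassoc_of% hu', hu, Category.comp_id]⟩, hu⟩

lemma IsKer.exists_iso {W W' X Y : A} {k : W ⟶ X} {k' : W' ⟶ X} {f : X ⟶ Y}
    (h : IsKer k f) (h' : IsKer k' f) : ∃ e : W ≅ W', e.hom ≫ k' = k := by
  obtain ⟨u, hu⟩ := h.lift k' h'.zero
  obtain ⟨u', hu'⟩ := h'.lift k h.zero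
  have := h.mono
  have := h'.mono
  exact ⟨⟨u', u, by rw [← cancel_mono k, Category.assoc, hu, hu', Category.id_comp],
    by rw [← cancel_mono k', Category.assoc, hu', hu, Category.id_comp]⟩, hu'⟩

lemma hasCokernels_of_isCoker (hc : ∀ {X Y : A} (f : X ⟶ Y), ∃ (W : A) (p : Y ⟶ W), IsCoker f p) :
    HasCokernels A where
  has_colimit f := by
    obtain ⟨W, p, hp⟩ := hc f
    exact ⟨⟨_, hp.isColimit⟩⟩

lemma hasKernels_of_isKer (hk : ∀ {X Y : A} (f : X ⟶ Y), ∃ (W : A) (k : W ⟶ X), IsKer k f) :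
    HasKernels A where
  has_limit f := by
    obtain ⟨W, p, hp⟩ := hk f
    exact ⟨⟨_, hp.isLimit⟩⟩

section

variable (R : ObjectProperty A)
  (hreg : ∀ T : A, ∃ (P S : A) (σ : S ⟶ P) (π : P ⟶ T), R P ∧ IsCoker σ π)
include hreg

/-- A monomorphism `f` is the kernel of its cokernel `p`: given `t` with `t ≫ p = 0`, lift it
through `f` on a cover `π : P ⟶ T` with `P` in `R`. The lift kills the relations `σ` because `f` is
mono, so it descends to `T`. -/
lemma isNormalMonoCategory_of_isCoker
    (hc : ∀ {X Y : A} (f : X ⟶ Y), ∃ (W : A) (p : Y ⟶ W), IsCoker f p)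
    (hex : ∀ {P X Y W : A} (f : X ⟶ Y) (p : Y ⟶ W), IsCoker f p → R P →
      ∀ t : P ⟶ Y, t ≫ p = 0 → ∃ u : P ⟶ X, u ≫ f = t) :
    IsNormalMonoCategory A where
  normalMonoOfMono {X Y} f _ := by
    obtain ⟨W, p, hp⟩ := hc f
    refine ⟨⟨W, p, hp.zero, (IsKer.mk ‹_› hp.zero fun {T} t ht ↦ ?_ : IsKer f p).isLimit⟩⟩
    obtain ⟨P, S, σ, π, hP, hπ⟩ := hreg T
    obtain ⟨v, hv⟩ := hex f p hp hP (π ≫ t) (by rw [Category.assoc, ht, comp_zero])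
    obtain ⟨u, hu⟩ := hπ.desc v (by
      rw [← cancel_mono f, Category.assoc, hv, reassoc_of% hπ.zero, zero_comp, zero_comp])
    have := hπ.epi
    exact ⟨u, by rw [← cancel_epi π, reassoc_of% hu, hv]⟩

/-- An epimorphism `f` is the cokernel of its kernel: if `t` kills the kernel, it kills every map
killed by `f`. Hence composing `t` with a lift through `f` of a projective cover of `Y` is well
defined on `Y`; that the result factors `t` is tested on a cover of `X`. -/
lemma isNormalEpiCategory_of_isKer
    (hk : ∀ {X Y : A} (f : X ⟶ Y), ∃ (W : A) (k : W ⟶ X), IsKer k f)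
    (hproj : ∀ {P : A}, R P → Projective P) :
    IsNormalEpiCategory A where
  normalEpiOfEpi {X Y} f _ := by
    obtain ⟨W, k, hk⟩ := hk f
    refine ⟨⟨W, k, hk.zero, (IsCoker.mk ‹_› hk.zero fun {T} t ht ↦ ?_ : IsCoker k f).isColimit⟩⟩
    have key : ∀ {Z : A} (z : Z ⟶ X), z ≫ f = 0 → z ≫ t = 0 := fun z hz ↦ by
      obtain ⟨w, rfl⟩ := hk.lift z hz
      rw [Category.assoc, ht, comp_zero]
    obtain ⟨P, S, σ, π, hP, hπ⟩ := hreg Y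
    have := hproj hP
    have := hπ.epi
    obtain ⟨v, hv⟩ := Projective.factors π f
    obtain ⟨u, hu⟩ := hπ.desc (v ≫ t) (by
      rw [← Category.assoc]
      exact key _ (by rw [Category.assoc, hv, hπ.zero]))
    refine ⟨u, ?_⟩
    obtain ⟨P', S', σ', π', hP', hπ'⟩ := hreg X
    have := hproj hP'
    have := hπ'.epi
    obtain ⟨w, hw⟩ := Projective.factors (π' ≫ f) π
    rw [← cancel_epi π', ← reassoc_of% hw, hu, ← sub_eq_zero, ← Category.assoc,
      ← Preadditive.sub_comp]
    exact key _ (by rw [Preadditive.sub_comp, Category.assoc, hv, hw, sub_self])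

end

end ElementaryCokernels

/-! ### Cokernels, projectives and abelianness of the quotient by `K` -/

section IdealQuotients

variable {B : Type u} [Category.{v} B] [Preadditive B] {E : ObjectProperty (ShortComplex B)}
  {C K D : ObjectProperty B} {A : Type*} [Category* A] [Preadditive A]

/-- `Q` is surjective on objects, full, and kills the morphisms that factor through `K`. -/
structure IsIdealQuotientFunctor (Q : B ⥤ A) (K : ObjectProperty B) : Prop where
  additive : Q.Additive
  obj_surjective : ∀ X : A, ∃ Y : B, Q.obj Y = X
  full : Q.Full
  map_eq_zero_iff : ∀ {X Y : B} {f : X ⟶ Y}, Q.map f = 0 ↔ FactorsThrough K f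

namespace IsIdealQuotientFunctor

variable {Q : B ⥤ A} (hQ : IsIdealQuotientFunctor Q K)
include hQ

lemma op : IsIdealQuotientFunctor Q.op K.op where
  additive := have := hQ.additive; inferInstance
  obj_surjective X := by
    obtain ⟨Y, hY⟩ := hQ.obj_surjective X.unop
    exact ⟨Opposite.op Y, congrArg Opposite.op hY⟩
  full := have := hQ.full; inferInstance
  map_eq_zero_iff {X Y f} := by
    have h : Q.op.map f = 0 ↔ Q.map f.unop = 0 :=
      ⟨fun h ↦ congrArg Quiver.Hom.unop h, fun h ↦ congrArg Quiver.Hom.op h⟩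
    rw [h, hQ.map_eq_zero_iff]
    exact ⟨fun h ↦ h.op, fun h ↦ h.unop⟩

lemma map_surjective {X Y : B} (f : Q.obj X ⟶ Q.obj Y) : ∃ g : X ⟶ Y, Q.map g = f :=
  have := hQ.full
  Q.map_surjective f

lemma map_eq_zero {X Y Z : B} (hZ : K Z) (a : X ⟶ Z) (b : Z ⟶ Y) : Q.map (a ≫ b) = 0 :=
  hQ.map_eq_zero_iff.2 ⟨Z, a, b, hZ, rfl⟩

lemma isZero_obj {X : B} (hX : K X) : IsZero (Q.obj X) := by
  rw [IsZero.iff_id_eq_zero, ← Q.map_id, hQ.map_eq_zero_iff]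
  exact ⟨X, 𝟙 X, 𝟙 X, hX, Category.comp_id _⟩

lemma map_sub {X Y : B} (f g : X ⟶ Y) : Q.map (f - g) = Q.map f - Q.map g :=
  have := hQ.additive
  Q.map_sub

lemma map_add {X Y : B} (f g : X ⟶ Y) : Q.map (f + g) = Q.map f + Q.map g :=
  have := hQ.additive
  Q.map_add

lemma map_eq_of_sub {X Y Z : B} {f g : X ⟶ Y} (hZ : K Z) (a : X ⟶ Z) (b : Z ⟶ Y)
    (hfg : f - g = a ≫ b) : Q.map f = Q.map g := by
  rw [← sub_eq_zero, ← hQ.map_sub, hfg, hQ.map_eq_zero hZ]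

lemma isCoker {X Y Z : B} {f : X ⟶ Y} {p : Y ⟶ Z} (hz : Q.map (f ≫ p) = 0)
    (hepi : ∀ {T : B} (u : Z ⟶ T), Q.map (p ≫ u) = 0 → Q.map u = 0)
    (hdesc : ∀ {T : B} (t : Y ⟶ T), Q.map (f ≫ t) = 0 → ∃ u : Z ⟶ T, Q.map (p ≫ u) = Q.map t) :
    IsCoker (Q.map f) (Q.map p) where
  epi := by
    refine Preadditive.epi_of_cancel_zero _ fun {T} u hu ↦ ?_
    obtain ⟨T, rfl⟩ := hQ.obj_surjective T
    obtain ⟨u, rfl⟩ := hQ.map_surjective u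
    exact hepi u (by rw [Q.map_comp, hu])
  zero := by rw [← Q.map_comp, hz]
  desc {T} t ht := by
    obtain ⟨T, rfl⟩ := hQ.obj_surjective T
    obtain ⟨t, rfl⟩ := hQ.map_surjective t
    obtain ⟨u, hu⟩ := hdesc t (by rw [Q.map_comp, ht])
    exact ⟨Q.map u, by rw [← Q.map_comp, hu]⟩

variable (h : RigidTwinCotorsion E C K D)
include h

/-- Morphisms out of a syzygy of an object of `C` vanish in the quotient if and only if they extend
to the projective object. -/
lemma map_eq_zero_iff_extends {S P Z : B} {j : S ⟶ P} {e : P ⟶ Z} (hje : IsConflation E j e)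
    (hP : projObj E P) (hZ : C Z) {T : B} {f : S ⟶ T} :
    Q.map f = 0 ↔ ∃ g : P ⟶ T, j ≫ g = f := by
  rw [hQ.map_eq_zero_iff]
  constructor
  · rintro ⟨W, a, b, hW, rfl⟩
    obtain ⟨a', ha'⟩ := h.extend_CK hje hZ hW a
    exact ⟨a' ≫ b, by rw [reassoc_of% ha']⟩
  · rintro ⟨g, rfl⟩
    exact ⟨P, j, g, h.projObj_K hP, rfl⟩

section Cokernels

variable {X Y K' C' W : B} {i : X ⟶ K'} {d : K' ⟶ C'} (hid : IsConflation E i d)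
  {g : X ⟶ Y} {i' : Y ⟶ W} {d' : W ⟶ C'} (hid' : IsConflation E i' d') {g' : K' ⟶ W}
  (h1 : i ≫ g' = g ≫ i') (h2 : g' ≫ d' = d)

include hid hid' h1 h2

/-- If `i' ≫ u` factors through `K`, its first factor extends over `W`, and what remains of `u`
factors through `C'`, which lies in `K`; so `i'` is epi in the quotient. If `g ≫ t` factors through
`K`, it extends over `K'`, and the pushout property glues this extension to `t`. -/
lemma isCoker_pushout (hK' : K K') (hC' : C C') : IsCoker (Q.map g) (Q.map i') := by
  refine hQ.isCoker ?_ (fun {T} u hu ↦ ?_) (fun {T} t ht ↦ ?_)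
  · rw [← h1, hQ.map_eq_zero hK']
  · obtain ⟨V, a, b, hV, hab⟩ := hQ.map_eq_zero_iff.1 hu
    obtain ⟨a', ha'⟩ := h.extend_CK hid' hC' hV a
    obtain ⟨z, hz⟩ := h.desc hid' (u - a' ≫ b) (by simp [reassoc_of% ha', hab])
    rw [sub_eq_iff_eq_add.1 hz.symm, hQ.map_add, hQ.map_eq_zero (h.C_K hC'), hQ.map_eq_zero hV,
      add_zero]
  · obtain ⟨V, a, b, hV, hab⟩ := hQ.map_eq_zero_iff.1 ht
    obtain ⟨a', ha'⟩ := h.extend_CK hid hC' hV a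
    obtain ⟨w, hw, -⟩ := h.pushout_desc hid hid' h1 h2 t (a' ≫ b) (by rw [reassoc_of% ha', hab])
    exact ⟨w, by rw [hw]⟩

/-- Morphisms from a syzygy of an object of `C` lift along `g` if they vanish on the cokernel
of `g`. -/
lemma exists_lift_of_pushout {S P Z : B} {j : S ⟶ P} {e : P ⟶ Z} (hje : IsConflation E j e)
    (hP : projObj E P) (hZ : C Z) (f : S ⟶ Y) (hf : Q.map (f ≫ i') = 0) :
    ∃ l : S ⟶ X, Q.map (l ≫ g) = Q.map f := by
  obtain ⟨v, hv⟩ := (hQ.map_eq_zero_iff_extends h hje hP hZ).1 hf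
  -- Lifting through `K'` splits `v` into a part `v' ≫ g'` and a part `y` in `Y`. The latter
  -- contributes only a map through `P`, and the former restricts on `S` to the required map to `X`.
  obtain ⟨v', hv'⟩ := TwinCotorsion.lift_proj hid hP (v ≫ d')
  obtain ⟨y, hy⟩ := h.lift hid' (v - v' ≫ g') (by simp [h2, hv'])
  have e1 : (f - j ≫ y) ≫ i' = j ≫ v' ≫ g' := by simp [hy, hv]
  obtain ⟨l, hl⟩ := h.lift hid (j ≫ v') (by
    have := (reassoc_of% e1) d'
    simpa [h2, hid'.zero] using this.symm)
  have := h.mono hid'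
  have e2 : l ≫ g = f - j ≫ y := by
    rw [← cancel_mono i', e1, Category.assoc, ← h1, reassoc_of% hl]
  exact ⟨l, hQ.map_eq_of_sub (h.projObj_K hP) (-j) y (by rw [e2]; simp)⟩

end Cokernels

lemma exists_isCoker {X Y : A} (f : X ⟶ Y) : ∃ (W : A) (p : Y ⟶ W), IsCoker f p := by
  obtain ⟨X, rfl⟩ := hQ.obj_surjective X
  obtain ⟨Y, rfl⟩ := hQ.obj_surjective Y
  obtain ⟨f, rfl⟩ := hQ.map_surjective f
  obtain ⟨K', C', i, d, hK', hC', hid⟩ := h.coresK X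
  obtain ⟨W, i', d', g', hid', h1, h2⟩ := h.pushout hid f
  exact ⟨_, _, hQ.isCoker_pushout h hid hid' h1 h2 hK' hC'⟩

lemma exists_isKer {X Y : A} (f : X ⟶ Y) : ∃ (W : A) (k : W ⟶ X), IsKer k f := by
  obtain ⟨W, p, hp⟩ := hQ.op.exists_isCoker h.op f.op
  exact ⟨_, _, hp.unop⟩

/-- Any cokernel of `f` factors the one constructed by pushout, so the lifting property transfers
from the latter. -/
lemma exists_lift_of_isCoker {S P Z : B} {j : S ⟶ P} {e : P ⟶ Z} (hje : IsConflation E j e)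
    (hP : projObj E P) (hZ : C Z) {X Y W : A} {f : X ⟶ Y} {p : Y ⟶ W} (hp : IsCoker f p)
    (t : Q.obj S ⟶ Y) (ht : t ≫ p = 0) : ∃ u : Q.obj S ⟶ X, u ≫ f = t := by
  obtain ⟨X, rfl⟩ := hQ.obj_surjective X
  obtain ⟨Y, rfl⟩ := hQ.obj_surjective Y
  obtain ⟨f, rfl⟩ := hQ.map_surjective f
  obtain ⟨t, rfl⟩ := hQ.map_surjective t
  obtain ⟨K', C', i, d, hK', hC', hid⟩ := h.coresK X
  obtain ⟨W', i', d', g', hid', h1, h2⟩ := h.pushout hid f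
  obtain ⟨v, hv⟩ := hp.desc _ (hQ.isCoker_pushout h hid hid' h1 h2 hK' hC').zero
  obtain ⟨l, hl⟩ := hQ.exists_lift_of_pushout h hid hid' h1 h2 hje hP hZ t (by
    rw [Q.map_comp, ← hv, reassoc_of% ht, zero_comp])
  exact ⟨Q.map l, by rw [← Q.map_comp, hl]⟩

/-- An epimorphism has zero cokernel, so every map from the syzygy satisfies the condition for
lifting. -/
lemma projective_obj_of_omega {S : B} (hS : omega E C S) : Projective (Q.obj S) where
  factors {X Y} t f _ := by
    obtain ⟨P, Z, j, e, hP, hZ, hje⟩ := hS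
    obtain ⟨W, p, hp⟩ := hQ.exists_isCoker h f
    have h0 : p = 0 := by rw [← cancel_epi f, hp.zero, comp_zero]
    exact hQ.exists_lift_of_isCoker h hje hP hZ hp t (by rw [h0, comp_zero])

section Presentations

variable {X K' C' S P : B} {i : X ⟶ K'} {d : K' ⟶ C'} (hid : IsConflation E i d)
  (hC' : C C') {j : S ⟶ P} {e : P ⟶ C'} (hje : IsConflation E j e)
  (hP : projObj E P) {q : P ⟶ K'} {π : S ⟶ X} (hq : q ≫ d = e) (hπ : π ≫ i = j ≫ q)

include hid hC' hje hP hq hπ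

/-- The square from `S ⟶ P` to `X ⟶ K'` is a pushout because both rows end in `C'`. If `π ≫ u`
vanishes, it extends over `P`, and gluing shows that `u` factors through `K'`. -/
lemma epi_map_of_coresolution (hK' : K K') : Epi (Q.map π) := by
  refine Preadditive.epi_of_cancel_zero _ fun {T} u hu ↦ ?_
  obtain ⟨T, rfl⟩ := hQ.obj_surjective T
  obtain ⟨u, rfl⟩ := hQ.map_surjective u
  rw [← Q.map_comp, hQ.map_eq_zero_iff_extends h hje hP hC'] at hu
  obtain ⟨v, hv⟩ := hu
  obtain ⟨w, rfl, -⟩ := h.pushout_desc hje hid hπ.symm hq u v hv.symm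
  exact hQ.map_eq_zero hK' _ _

lemma isCoker_of_coresolution (hK' : C K') {S₀ P₀ : B} {j₀ : S₀ ⟶ P₀} {e₀ : P₀ ⟶ K'}
    (hje₀ : IsConflation E j₀ e₀) (hP₀ : projObj E P₀) {l : P₀ ⟶ P} {b : S₀ ⟶ S}
    (hl : l ≫ e = e₀ ≫ d) (hb : b ≫ j = j₀ ≫ l) : IsCoker (Q.map b) (Q.map π) := by
  have hepi := hQ.epi_map_of_coresolution h hid hC' hje hP hq hπ (h.C_K hK')
  have := h.mono hid
  refine hQ.isCoker ?_ (fun {T} u hu ↦ ?_) (fun {T} t ht ↦ ?_)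
  · obtain ⟨r, hr⟩ := h.lift hid (l ≫ q - e₀) (by simp [hq, hl])
    have : b ≫ π = j₀ ≫ r := by
      rw [← cancel_mono i, Category.assoc, Category.assoc, hπ, hr, reassoc_of% hb]
      simp [hje₀.zero]
    rw [this, hQ.map_eq_zero (h.projObj_K hP₀)]
  · rwa [Q.map_comp, ← comp_zero (Y := Q.obj X) (f := Q.map π), cancel_epi] at hu
  · obtain ⟨v, hv⟩ := (hQ.map_eq_zero_iff_extends h hje₀ hP₀ hK').1 ht
    -- The pushout is the extension of `C'` by `T` classified by `t`. Since `b ≫ t` extends over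
    -- `P₀`, this extension acquires a map `s` from `K'` over `C'`. Restricting `s` to the kernels
    -- `X` and `T` gives `u`, and `π ≫ u` differs from `t` by a map through `P`.
    obtain ⟨M', i', d', g', hid', h1, h2⟩ := h.pushout hje t
    obtain ⟨s, hs⟩ := h.desc hje₀ (l ≫ g' - v ≫ i') (by
      simp [← reassoc_of% hb, h1, reassoc_of% hv])
    have hsd : s ≫ d' = d := by
      have := h.epi hje₀
      rw [← cancel_epi e₀, reassoc_of% hs]
      simp [h2, hl, hid'.zero]
    obtain ⟨u, hu⟩ := h.lift hid' (i ≫ s) (by simp [hsd, hid.zero])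
    obtain ⟨y, hy⟩ := h.lift hid' (q ≫ s - g') (by simp [hsd, hq, h2])
    have := h.mono hid'
    refine ⟨u, hQ.map_eq_of_sub (h.projObj_K hP) j y ?_⟩
    rw [← cancel_mono i', Category.assoc, hy]
    simp [hu, reassoc_of% hπ, h1]

end Presentations

lemma exists_omega_epi (X : A) : ∃ (S : B) (π : Q.obj S ⟶ X), omega E C S ∧ Epi π := by
  obtain ⟨X, rfl⟩ := hQ.obj_surjective X
  obtain ⟨K', C', i, d, hK', hC', hid⟩ := h.coresK X
  obtain ⟨S, P, j, e, hP, hje⟩ := h.enoughProj C'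
  obtain ⟨q, hq⟩ := TwinCotorsion.lift_proj hid hP e
  obtain ⟨π, hπ⟩ := h.lift hid (j ≫ q) (by simp [hq, hje.zero])
  exact ⟨S, Q.map π, ⟨P, C', j, e, hP, hC', hje⟩,
    hQ.epi_map_of_coresolution h hid hC' hje hP hq hπ hK'⟩

lemma exists_presentation {X : B} (hX : coCone E C C X) : ∃ (S₀ S : B) (b : S₀ ⟶ S) (π : S ⟶ X),
    omega E C S ∧ IsCoker (Q.map b) (Q.map π) := by
  obtain ⟨K', C', i, d, hK', hC', hid⟩ := hX
  obtain ⟨S, P, j, e, hP, hje⟩ := h.enoughProj C'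
  obtain ⟨q, hq⟩ := TwinCotorsion.lift_proj hid hP e
  obtain ⟨π, hπ⟩ := h.lift hid (j ≫ q) (by simp [hq, hje.zero])
  obtain ⟨S₀, P₀, j₀, e₀, hP₀, hje₀⟩ := h.enoughProj K'
  obtain ⟨l, hl⟩ := TwinCotorsion.lift_proj hje hP₀ (e₀ ≫ d)
  obtain ⟨b, hb⟩ := h.lift hje (j₀ ≫ l) (by simp [hl, hje₀.zero_assoc])
  exact ⟨S₀, S, b, π, ⟨P, C', j, e, hP, hC', hje⟩,
    hQ.isCoker_of_coresolution h hid hC' hje hP hq hπ hK' hje₀ hP₀ hl hb⟩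

lemma enoughProjectives : EnoughProjectives A where
  presentation X := by
    obtain ⟨S, π, hS, hπ⟩ := hQ.exists_omega_epi h X
    have := hQ.projective_obj_of_omega h hS
    exact ⟨{ p := Q.obj S, f := π }⟩

/-- A quotient in which every object has a presentation by syzygies of objects of `C` is abelian. -/
noncomputable abbrev abelian [HasFiniteProducts A]
    (hC : ∀ X : A, ∃ Y : B, coCone E C C Y ∧ Nonempty (Q.obj Y ≅ X)) : Abelian A :=
  have hreg : ∀ T : A, ∃ (P S : A) (σ : S ⟶ P) (π : P ⟶ T),
      (∃ S, omega E C S ∧ Q.obj S = P) ∧ IsCoker σ π := fun T ↦ by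
    obtain ⟨Y, hY, ⟨eY⟩⟩ := hC T
    obtain ⟨S₀, S, b, π, hS, hπ⟩ := hQ.exists_presentation h hY
    have := hπ.epi
    exact ⟨_, _, Q.map b, Q.map π ≫ eY.hom, ⟨S, hS, rfl⟩,
      ⟨inferInstance, by rw [reassoc_of% hπ.zero, zero_comp], fun t ht ↦ by
        obtain ⟨u, hu⟩ := hπ.desc t ht
        exact ⟨eY.inv ≫ u, by simp [hu]⟩⟩⟩
  { ‹Preadditive A› with
    toIsNormalMonoCategory := isNormalMonoCategory_of_isCoker _ hreg (hQ.exists_isCoker h)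
      (by
        rintro _ X Y W f p hp ⟨S, ⟨P, Z, j, e, hP, hZ, hje⟩, rfl⟩ t ht
        exact hQ.exists_lift_of_isCoker h hje hP hZ hp t ht)
    toIsNormalEpiCategory := isNormalEpiCategory_of_isKer _ hreg (hQ.exists_isKer h)
      (by
        rintro _ ⟨S, hS, rfl⟩
        exact hQ.projective_obj_of_omega h hS)
    has_kernels := hasKernels_of_isKer (hQ.exists_isKer h)
    has_cokernels := hasCokernels_of_isCoker (hQ.exists_isCoker h) }

end IsIdealQuotientFunctor

end IdealQuotients

/-! ### Local objects and quasi-regular endomorphisms -/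

section LocalObjects

variable {B : Type u} [Category.{v} B] [Preadditive B]

/-- `X` is nonzero, and one of two endomorphisms of `X` with sum `𝟙 X` is invertible. -/
structure IsLocalObj (X : B) : Prop where
  not_isZero : ¬ IsZero X
  isIso_or : ∀ f g : X ⟶ X, f + g = 𝟙 X → IsIso f ∨ IsIso g

lemma IsLocalObj.unop {X : Bᵒᵖ} (hX : IsLocalObj X) : IsLocalObj X.unop where
  not_isZero h := hX.not_isZero h.op
  isIso_or f g hfg := by
    rcases hX.isIso_or f.op g.op (congrArg Quiver.Hom.op hfg) with h | h
    · exact Or.inl ((isIso_op_iff f).1 h)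
    · exact Or.inr ((isIso_op_iff g).1 h)

lemma IsLocalObj.op {X : B} (hX : IsLocalObj X) : IsLocalObj (Opposite.op X) where
  not_isZero h := hX.not_isZero h.unop
  isIso_or f g hfg := by
    rcases hX.isIso_or f.unop g.unop (congrArg Quiver.Hom.unop hfg) with h | h
    · exact Or.inl ((isIso_unop_iff f).1 h)
    · exact Or.inr ((isIso_unop_iff g).1 h)

variable (B) in
/-- Properties that are inherited by direct sums and hold for zero objects and objects with local
endomorphism rings hold for all objects. -/
def LocalInduction : Prop :=
  ∀ Φ : ObjectProperty B, (∀ X, IsZero X → Φ X) →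
    (∀ X Y Z, DirectSum X Y Z → Φ Y → Φ Z → Φ X) → (∀ X, IsLocalObj X → Φ X) → ∀ X, Φ X

lemma LocalInduction.op (h : LocalInduction B) : LocalInduction Bᵒᵖ :=
  fun Φ h0 hs hl X ↦ h (fun X ↦ Φ (Opposite.op X)) (fun _ hX ↦ h0 _ hX.op)
    (fun _ _ _ s hY hZ ↦ hs _ _ _ s.op hY hZ) (fun _ hX ↦ hl _ hX.op) X.unop

/-- Endomorphisms of `X` that factor through `K` are quasi-regular. -/
def IsRadical (K : ObjectProperty B) (X : B) : Prop :=
  ∀ f : X ⟶ X, FactorsThrough K f → IsIso (𝟙 X - f)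

lemma IsRadical.op {K : ObjectProperty B} {X : B} (hX : IsRadical K X) :
    IsRadical K.op (Opposite.op X) :=
  fun f hf ↦ (isIso_unop_iff _).1 (hX f.unop hf.unop)

lemma IsLocalObj.exists_isIso {X : B} (hX : IsLocalObj X) {a b : X ⟶ X} (h : IsIso (a + b)) :
    IsIso a ∨ IsIso b := by
  rcases hX.isIso_or (a ≫ inv (a + b)) (b ≫ inv (a + b))
    (by rw [← Preadditive.add_comp, IsIso.hom_inv_id]) with h' | h'
  · exact Or.inl (IsIso.of_isIso_comp_right a (inv (a + b)))
  · exact Or.inr (IsIso.of_isIso_comp_right b (inv (a + b)))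

/-- `W` contains the objects with local endomorphism rings that are retracts of its objects if it is
closed under direct summands. -/
lemma LocalInduction.of_retract [HasZeroObject B] (h : LocalInduction B) {J : B}
    (hJ : IsLocalObj J) {W : ObjectProperty B}
    (hW : ∀ {X Y Z : B}, DirectSum X Y Z → W X → W Y) (S : B) :
    ∀ (a : J ⟶ S) (b : S ⟶ J), IsIso (a ≫ b) → W S → W J := by
  refine h (fun S ↦ ∀ (a : J ⟶ S) (b : S ⟶ J), IsIso (a ≫ b) → W S → W J)
    (fun S hS a b hab _ ↦ ?_) (fun S Y Z s hY hZ a b hab hWS ↦ ?_) (fun S hS a b hab hWS ↦ ?_) S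
  · have : a ≫ b = 0 := by rw [hS.eq_zero_of_src b, comp_zero]
    rw [this] at hab
    refine (hJ.not_isZero ?_).elim
    rw [IsZero.iff_id_eq_zero, ← IsIso.hom_inv_id (0 : J ⟶ J), zero_comp]
  · have e : a ≫ b = (a ≫ s.p) ≫ (s.i ≫ b) + (a ≫ s.q) ≫ (s.j ≫ b) := by
      have := congrArg (fun t ↦ a ≫ t ≫ b) s.total
      simpa using this.symm
    rw [e] at hab
    rcases hJ.exists_isIso hab with h' | h'
    · exact hY _ _ h' (hW s hWS)
    · exact hZ _ _ h' (hW s.symm hWS)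
  · obtain ⟨b', e1⟩ : ∃ b' : S ⟶ J, a ≫ b' = 𝟙 J :=
      ⟨b ≫ inv (a ≫ b), by rw [← Category.assoc, IsIso.hom_inv_id]⟩
    -- `b' ≫ a` is idempotent, so it is the identity if it is invertible, and zero if its complement
    -- is.
    rcases hS.isIso_or (b' ≫ a) (𝟙 S - b' ≫ a) (by abel) with h' | h'
    · have e2 : b' ≫ a = 𝟙 S := by
        rw [← cancel_epi (b' ≫ a), Category.assoc, reassoc_of% e1, Category.comp_id]
      obtain ⟨Z, hZ⟩ := HasZeroObject.zero (C := B)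
      exact hW (Z := Z) ⟨a, b', 0, 0, e1, hZ.eq_of_src _ _, by rw [e2, zero_comp, add_zero]⟩ hWS
    · refine (hJ.not_isZero ?_).elim
      have e2 : b' ≫ a = 0 := by
        rw [← cancel_mono (𝟙 S - b' ≫ a), zero_comp, Preadditive.comp_sub, Category.comp_id,
          Category.assoc, reassoc_of% e1, sub_self]
      have e3 := congrArg (fun t ↦ a ≫ t ≫ b') e2
      rw [IsZero.iff_id_eq_zero]
      simpa [reassoc_of% e1, e1] using e3

variable {E : ObjectProperty (ShortComplex B)} {C K D : ObjectProperty B}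

/-- If an endomorphism through `K` were invertible, `X` would be a retract of an object of `K`. -/
lemma TwinCotorsion.isRadical_of_isLocalObj (h : TwinCotorsion E C K D) {X : B}
    (hX : IsLocalObj X) (hK : ¬ K X) : IsRadical K X := by
  rintro _ ⟨Z, a, b, hZ, rfl⟩
  refine (hX.isIso_or (𝟙 X - a ≫ b) (a ≫ b) (by abel)).resolve_right fun _ ↦ hK ?_
  exact h.retract_K a (b ≫ inv (a ≫ b)) (by rw [← Category.assoc, IsIso.hom_inv_id]) hZ

end LocalObjects

/-! ### Projective dimension one and the vanishing of `Ωx` -/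

section Gorenstein

variable {B : Type u} [Category.{v} B] [Preadditive B] {E : ObjectProperty (ShortComplex B)}
  {C K D : ObjectProperty B}

/-- An extension of an object of `ΣD` by an object of `D` is a quotient of objects of `D`. -/
lemma TwinCotorsion.cone_of_sigma (h : TwinCotorsion E C K D) {D' X S : B} {a : D' ⟶ X}
    {b : X ⟶ S} (hab : IsConflation E a b) (hD' : D D') (hS : sigma E D S) : cone E D D X := by
  obtain ⟨D₀, I, j, e, hD₀, hI, hje⟩ := hS
  -- The pullback `Y` is also an extension of `I` by `D'`. It splits because `I` lies in `K`, so `Y`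
  -- is the direct sum of `D'` and `I` and belongs to `D`.
  obtain ⟨Y, m, n, w, hmn, h1, h2⟩ := h.pullback hje b
  refine ⟨D₀, Y, m, n, hD₀, ?_, hmn⟩
  obtain ⟨t, ht1, ht2⟩ := h.pullback_lift hje hmn h1 h2 a 0 (by rw [hab.zero, zero_comp])
  obtain ⟨s, hs⟩ := h.lift_KD hab hD' (h.injObj_K hI) e
  obtain ⟨σ, hσ1, hσ2⟩ := h.pullback_lift hje hmn h1 h2 s (𝟙 I) (by rw [hs, Category.id_comp])
  obtain ⟨p, hp⟩ := h.lift hab (n - w ≫ s) (by simp [hs, h1])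
  have := h.mono hab
  have := h.mono hje
  refine h.sum_D (Y := D') (Z := I) ⟨t, p, σ, w, ?_, hσ2, ?_⟩ hD' (h.injObj_D hI)
  · rw [← cancel_mono a, Category.assoc, hp]
    simp [ht1, reassoc_of% ht2]
  · obtain ⟨y, hy⟩ := h.lift hmn (p ≫ t + w ≫ σ - 𝟙 Y) (by simp [ht1, hσ1, hp])
    have hy0 : y = 0 := by
      rw [← cancel_mono j, ← h2, ← Category.assoc, hy]
      simp [ht2, hσ2]
    rw [← sub_eq_zero, ← hy, hy0, zero_comp]

section Syzygies

variable (h : RigidTwinCotorsion E C K D)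
  {X C₁ C₂ S₀ P₀ S₁ P₁ S₂ P₂ : B} {x : X ⟶ C₁} {c : C₁ ⟶ C₂} (hxc : IsConflation E x c)
  {j₀ : S₀ ⟶ P₀} {e₀ : P₀ ⟶ X} {j₁ : S₁ ⟶ P₁} {e₁ : P₁ ⟶ C₁} {j₂ : S₂ ⟶ P₂} {e₂ : P₂ ⟶ C₂}
  (h₀ : IsConflation E j₀ e₀) (h₁ : IsConflation E j₁ e₁) (h₂ : IsConflation E j₂ e₂)
  (hP₁ : projObj E P₁) (hP₂ : projObj E P₂)
  {p : P₀ ⟶ P₁} {a : S₀ ⟶ S₁} (hp : p ≫ e₁ = e₀ ≫ x) (ha : j₀ ≫ p = a ≫ j₁)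
  {l : P₁ ⟶ P₂} {b : S₁ ⟶ S₂} (hl : l ≫ e₂ = e₁ ≫ c) (hb : b ≫ j₂ = j₁ ≫ l)
  {A : Type*} [Category* A]

section

variable [Preadditive A] {Q : B ⥤ A} (hQ : IsIdealQuotientFunctor Q K)
include hQ h hxc h₀ h₁ h₂ hP₁ hP₂ hp ha hl hb

/-- The sequence of syzygies `ΩX ⟶ ΩC₁ ⟶ ΩC₂` is exact in the quotient with respect to morphisms
from syzygies of objects of `C`. -/
lemma IsIdealQuotientFunctor.exists_factor_omega {S P Z : B} {j : S ⟶ P} {e : P ⟶ Z}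
    (hje : IsConflation E j e) (hP : projObj E P) (hZ : C Z) (f : S ⟶ S₁)
    (hf : Q.map (f ≫ b) = 0) : ∃ (s : Z ⟶ X) (s' : P ⟶ P₀) (σ : S ⟶ S₀),
      s' ≫ e₀ = e ≫ s ∧ σ ≫ j₀ = j ≫ s' ∧ Q.map f = Q.map (σ ≫ a) := by
  have := h.epi hje
  have := h.mono h₁
  -- This exhibits `f` as `Ωφ` for some `φ : Z ⟶ C₁`. The vanishing of `f ≫ b` makes `φ ≫ c` factor
  -- through `P₂`, by `w`. Subtracting `w ≫ q`, whose syzygy vanishes, leaves a map that factors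
  -- through `x` by `s`; then `f` and `Ωs ≫ a` agree in the quotient.
  obtain ⟨f', hf'⟩ := h.extend_CK hje hZ (h.projObj_K hP₁) (f ≫ j₁)
  obtain ⟨φ, hφ⟩ := h.desc hje (f' ≫ e₁) (by rw [reassoc_of% hf', h₁.zero, comp_zero])
  obtain ⟨v, hv⟩ := (hQ.map_eq_zero_iff_extends h hje hP hZ).1 hf
  obtain ⟨w, hw⟩ := h.desc hje (f' ≫ l - v ≫ j₂) (by
    simp [reassoc_of% hf', reassoc_of% hv, hb])
  have hwφ : w ≫ e₂ = φ ≫ c := by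
    rw [← cancel_epi e, reassoc_of% hw, reassoc_of% hφ]
    simp [hl, h₂.zero]
  obtain ⟨q, hq⟩ := TwinCotorsion.lift_proj hxc hP₂ e₂
  obtain ⟨q', hq'⟩ := TwinCotorsion.lift_proj h₁ hP₂ q
  obtain ⟨s, hs⟩ := h.lift hxc (φ - w ≫ q) (by simp [hq, hwφ])
  obtain ⟨s', hs'⟩ := TwinCotorsion.lift_proj h₀ hP (e ≫ s)
  obtain ⟨σ, hσ⟩ := h.lift h₀ (j ≫ s') (by rw [Category.assoc, hs', hje.zero_assoc, zero_comp])
  obtain ⟨z, hz⟩ := h.lift h₁ (f' - s' ≫ p - e ≫ w ≫ q') (by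
    simp [hp, hq', reassoc_of% hs', hs, hφ])
  refine ⟨s, s', σ, hs', hσ, hQ.map_eq_of_sub (h.projObj_K hP) j z ?_⟩
  rw [← cancel_mono j₁, Category.assoc, hz]
  simp [hf', ← ha, reassoc_of% hσ, hje.zero_assoc]

end

variable [Abelian A] {Q : B ⥤ A} (hQ : IsIdealQuotientFunctor Q K)
  (hC₁ : C C₁) (hC₂ : C C₂)
include hQ h hxc h₀ h₁ hP₁ hp ha hC₁ hC₂

/-- By exactness at `ΩC₁`, maps from objects of `ΩC` killed by `b` factor through `a`, hence vanish.
Such objects cover everything, so `b` is mono and `0 ⟶ ΩC₁ ⟶ ΩC₂ ⟶ X ⟶ 0` is a projective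
resolution. -/
lemma IsIdealQuotientFunctor.hasProjectiveDimensionLE_one (haz : Q.map a = 0) :
    HasProjectiveDimensionLE (Q.obj X) 1 := by
  obtain ⟨S₂, P₂, j₂, e₂, hP₂, h₂⟩ := h.enoughProj C₂
  obtain ⟨q, hq⟩ := TwinCotorsion.lift_proj hxc hP₂ e₂
  obtain ⟨π, hπ⟩ := h.lift hxc (j₂ ≫ q) (by simp [hq, h₂.zero])
  obtain ⟨l, hl⟩ := TwinCotorsion.lift_proj h₂ hP₁ (e₁ ≫ c)
  obtain ⟨b, hb⟩ := h.lift h₂ (j₁ ≫ l) (by simp [hl, h₁.zero_assoc])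
  have hcok := hQ.isCoker_of_coresolution h hxc hC₂ h₂ hP₂ hq hπ hC₁ h₁ hP₁ hl hb
  have hmono : Mono (Q.map b) := by
    refine Preadditive.mono_of_cancel_zero _ fun {T} t ht ↦ ?_
    obtain ⟨S, ω, ⟨P, Z, j, e, hP, hZ, hje⟩, hω⟩ := hQ.exists_omega_epi h T
    obtain ⟨f, hf⟩ := hQ.map_surjective (ω ≫ t)
    obtain ⟨-, -, σ, -, -, hσ⟩ := hQ.exists_factor_omega h hxc h₀ h₁ h₂ hP₁ hP₂ hp ha hl hb
      hje hP hZ f (by rw [Q.map_comp, hf, Category.assoc, ht, comp_zero])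
    rw [← cancel_epi ω, ← hf, hσ, Q.map_comp, haz, comp_zero, comp_zero]
  have := hcok.epi
  have hS : (ShortComplex.mk _ _ hcok.zero).ShortExact :=
    ⟨ShortComplex.exact_of_g_is_cokernel _ hcok.isColimit⟩
  have := hQ.projective_obj_of_omega h ⟨P₁, C₁, j₁, e₁, hP₁, hC₁, h₁⟩
  have := hQ.projective_obj_of_omega h ⟨P₂, C₂, j₂, e₂, hP₂, hC₂, h₂⟩
  exact hS.hasProjectiveDimensionLT_X₃ 1 (inferInstanceAs (HasProjectiveDimensionLT (Q.obj S₁) 1))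
    (inferInstanceAs (HasProjectiveDimensionLT (Q.obj S₂) (1 + 1)))

/-- The image of `ΩC₁ ⟶ ΩC₂` is the kernel of a projective cover of `X`, hence projective, so `ΩC₁`
splits over it. The projection onto the complement is `Ωs` followed by `a`, which gives `a = aσa` in
the quotient with `σ = Ωs`. Quasi-regularity of `x ≫ s` makes `1 - aσ` left cancellable, so `a = 0`.
-/
lemma IsIdealQuotientFunctor.map_omega_eq_zero (hP₀ : projObj E P₀) (hX : IsRadical K X)
    (hpd : HasProjectiveDimensionLE (Q.obj X) 1) : Q.map a = 0 := by
  obtain ⟨S₂, P₂, j₂, e₂, hP₂, h₂⟩ := h.enoughProj C₂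
  obtain ⟨q, hq⟩ := TwinCotorsion.lift_proj hxc hP₂ e₂
  obtain ⟨π, hπ⟩ := h.lift hxc (j₂ ≫ q) (by simp [hq, h₂.zero])
  obtain ⟨l, hl⟩ := TwinCotorsion.lift_proj h₂ hP₁ (e₁ ≫ c)
  obtain ⟨b, hb⟩ := h.lift h₂ (j₁ ≫ l) (by simp [hl, h₁.zero_assoc])
  have hcok := hQ.isCoker_of_coresolution h hxc hC₂ h₂ hP₂ hq hπ hC₁ h₁ hP₁ hl hb
  have := hcok.epi
  have hab : Q.map a ≫ Q.map b = 0 := by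
    obtain ⟨y, hy⟩ := h.lift h₂ (p ≫ l) (by
      rw [Category.assoc, hl, reassoc_of% hp, hxc.zero, comp_zero])
    have := h.mono h₂
    rw [← Q.map_comp, ← hQ.map_eq_zero (h.projObj_K hP₀) j₀ y]
    congr 1
    rw [← cancel_mono j₂, Category.assoc, Category.assoc, hb, hy, reassoc_of% ha]
  have hS : (ShortComplex.mk (kernel.ι (Q.map π)) (Q.map π) (kernel.condition _)).ShortExact :=
    ⟨ShortComplex.exact_kernel _⟩
  have := hQ.projective_obj_of_omega h ⟨P₂, C₂, j₂, e₂, hP₂, hC₂, h₂⟩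
  have hZ : HasProjectiveDimensionLT (kernel (Q.map π)) 1 :=
    hS.hasProjectiveDimensionLT_X₁ 1 (inferInstanceAs (HasProjectiveDimensionLT (Q.obj S₂) 1)) hpd
  have hβ : Epi (kernel.lift (Q.map π) (Q.map b) hcok.zero) :=
    (ShortComplex.exact_of_g_is_cokernel (ShortComplex.mk _ _ hcok.zero)
      hcok.isColimit).epi_kernelLift
  set β := kernel.lift (Q.map π) (Q.map b) hcok.zero with hβdef
  have hβι : β ≫ kernel.ι _ = Q.map b := kernel.lift_ι _ _ _
  obtain ⟨τ, hτ⟩ := Projective.factors (𝟙 (kernel (Q.map π))) β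
  have haβ : Q.map a ≫ β = 0 := by
    rw [← cancel_mono (kernel.ι _), Category.assoc, hβι, hab, zero_comp]
  -- This is the projection onto the kernel of `b`; being killed by `b`, it factors through `a`.
  obtain ⟨f, hf⟩ := hQ.map_surjective (𝟙 (Q.obj S₁) - β ≫ τ)
  obtain ⟨s, s', σ, hs', hσ, hfσ⟩ := hQ.exists_factor_omega h hxc h₀ h₁ h₂ hP₁ hP₂ hp ha hl hb
    h₁ hP₁ hC₁ f (by
      rw [Q.map_comp, hf, ← hβι]
      simp [reassoc_of% hτ])
  have ha1 : Q.map (a ≫ σ) ≫ Q.map a = Q.map a := by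
    rw [Q.map_comp, Category.assoc, ← Q.map_comp σ, ← hfσ, hf]
    simp [reassoc_of% haβ]
  -- Apply `Ω` to the inverse of `𝟙 X - x ≫ s`: the result `η` satisfies `η (1 - aσ) = 1` modulo
  -- maps through `P₀`, with `θ` recording the discrepancy.
  have := hX (x ≫ s) ⟨C₁, x, s, h.C_K hC₁, rfl⟩
  obtain ⟨y', hy'⟩ := TwinCotorsion.lift_proj h₀ hP₀ (e₀ ≫ inv (𝟙 X - x ≫ s))
  obtain ⟨η, hη⟩ := h.lift h₀ (j₀ ≫ y') (by
    rw [Category.assoc, hy', h₀.zero_assoc, zero_comp])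
  obtain ⟨θ, hθ⟩ := h.lift h₀ (y' - y' ≫ p ≫ s' - 𝟙 P₀) (by
    have e : y' ≫ e₀ - y' ≫ e₀ ≫ x ≫ s = e₀ := by
      have e' := IsIso.inv_hom_id (𝟙 X - x ≫ s)
      rw [Preadditive.comp_sub, Category.comp_id] at e'
      rw [reassoc_of% hy', hy', ← Preadditive.comp_sub, e', Category.comp_id]
    simp [hs', reassoc_of% hp, e])
  have hη1 : Q.map (η - η ≫ a ≫ σ) = 𝟙 _ := by
    rw [← Q.map_id]
    refine hQ.map_eq_of_sub (h.projObj_K hP₀) j₀ θ ?_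
    have := h.mono h₀
    rw [← cancel_mono j₀, Category.assoc, hθ]
    simp [hη, hσ, ← reassoc_of% ha, reassoc_of% hη]
  rw [← Category.id_comp (Q.map a), ← hη1, hQ.map_sub, Q.map_comp, Preadditive.sub_comp,
    Category.assoc, ha1, sub_self]

end Syzygies

variable {A : Type*} [Category* A] [Abelian A] {Q : B ⥤ A} (hQ : IsIdealQuotientFunctor Q K)
  (h : RigidTwinCotorsion E C K D)

namespace IsIdealQuotientFunctor

include hQ

/-- The difference between the composite and the identity factors through `K`, so retracts in the
quotient lift to `B`. -/
lemma isIso_comp_of_map_eq_id {X Y : B} (hX : IsRadical K X) {a : X ⟶ Y} {b : Y ⟶ X}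
    (hab : Q.map a ≫ Q.map b = 𝟙 _) : IsIso (a ≫ b) := by
  have := hX (𝟙 X - a ≫ b) (by
    rw [← hQ.map_eq_zero_iff, hQ.map_sub, Q.map_comp, hab, Q.map_id, sub_self])
  simpa using this

include h

lemma isKer_pullback {A' K' Z Z' M' : B} {i : A' ⟶ K'} {d : K' ⟶ Z} (hid : IsConflation E i d)
    (hA' : D A') (hK' : K K') {i' : A' ⟶ M'} {d' : M' ⟶ Z'} (hid' : IsConflation E i' d')
    {f : Z' ⟶ Z} {f' : M' ⟶ K'} (h1 : f' ≫ d = d' ≫ f) (h2 : i' ≫ f' = i) :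
    IsKer (Q.map d') (Q.map f) :=
  (hQ.op.isCoker_pushout h.op hid.op hid'.op (congrArg Quiver.Hom.op h1)
    (congrArg Quiver.Hom.op h2) hK' hA').unop

lemma exists_sigma_mono (X : A) : ∃ (S : B) (ι : X ⟶ Q.obj S), sigma E D S ∧ Mono ι := by
  obtain ⟨S, π, hS, hπ⟩ := hQ.op.exists_omega_epi h.op (Opposite.op X)
  exact ⟨S.unop, π.unop, omega_opClass.1 hS, unop_mono_of_epi π⟩

lemma injective_obj_of_sigma {S : B} (hS : sigma E D S) : Injective (Q.obj S) := by
  have := hQ.op.projective_obj_of_omega h.op (S := Opposite.op S) (omega_opClass.2 hS)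
  exact (Injective.injective_iff_projective_op).2 this

lemma enoughInjectives : EnoughInjectives A where
  presentation X := by
    obtain ⟨S, ι, hS, hι⟩ := hQ.exists_sigma_mono h X
    have := hQ.injective_obj_of_sigma h hS
    exact ⟨{ J := Q.obj S, f := ι }⟩

variable [HasZeroObject B] (hind : LocalInduction B)
include hind

/-- Indecomposable objects outside `K` are quotients of objects of `D`. -/
lemma cone_of_isLocalObj {X : B} (hX : IsLocalObj X) (hK : ¬ K X) : cone E D D X := by
  -- An injective copresentation realises `X` as the kernel of a map from `S₀` to `S₁`. The same
  -- kernel is computed by the pullback `X'`, an extension of `S₀` by an object of `D`; hence `X` is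
  -- a retract of `X'`.
  obtain ⟨S₀, ι, hS₀, _⟩ := hQ.exists_sigma_mono h (Q.obj X)
  obtain ⟨S₁, κ, ⟨D₁, I₁, j₁, e₁, hD₁, hI₁, h₁⟩, _⟩ := hQ.exists_sigma_mono h (cokernel ι)
  obtain ⟨f, hf⟩ := hQ.map_surjective (cokernel.π ι ≫ κ)
  obtain ⟨X', a, b, w, hab, h1, h2⟩ := h.pullback h₁ f
  have hker := hQ.isKer_pullback h h₁ hD₁ (h.injObj_K hI₁) hab h1 h2
  have hker' : IsKer ι (Q.map f) := by
    refine ⟨inferInstance, by rw [hf, cokernel.condition_assoc, zero_comp], fun t ht ↦ ?_⟩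
    have ht' : t ≫ cokernel.π ι = 0 := by
      rw [← cancel_mono κ, Category.assoc, ← hf, ht, zero_comp]
    exact ⟨Abelian.monoLift ι t ht', Abelian.monoLift_comp ι t ht'⟩
  obtain ⟨φ, -⟩ := hker'.exists_iso hker
  obtain ⟨u, hu⟩ := hQ.map_surjective φ.hom
  obtain ⟨u', hu'⟩ := hQ.map_surjective φ.inv
  refine hind.of_retract hX (W := cone E D D) ?_ X' u u'
    (hQ.isIso_comp_of_map_eq_id (h.isRadical_of_isLocalObj hX hK)
      (by rw [hu, hu', Iso.hom_inv_id])) (h.cone_of_sigma hab hD₁ hS₀)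
  rintro X Y Z s ⟨A, M, i, d, hA, hM, hid⟩
  obtain ⟨N, n, hN, hn⟩ := h.exists_conflation_of_directSum hid hA hM s
  exact ⟨N, M, n, _, hN, hM, hn⟩

/-- The embedding into an object from `ΣD` splits in the quotient, the splitting lifts to `B`, and
`ΣD` is closed under direct summands. -/
lemma sigma_of_injective {X : B} (hX : IsLocalObj X) (hK : ¬ K X) (hI : Injective (Q.obj X)) :
    sigma E D X := by
  obtain ⟨S, ι, hS, _⟩ := hQ.exists_sigma_mono h (Q.obj X)
  obtain ⟨ρ, hρ⟩ := Injective.factors (𝟙 (Q.obj X)) ι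
  obtain ⟨u, rfl⟩ := hQ.map_surjective ι
  obtain ⟨u', rfl⟩ := hQ.map_surjective ρ
  refine hind.of_retract hX (W := sigma E D) ?_ S u u'
    (hQ.isIso_comp_of_map_eq_id (h.isRadical_of_isLocalObj hX hK) hρ) hS
  rintro X Y Z s ⟨A, M, i, d, hA, hM, hid⟩
  obtain ⟨N, n, hN, hn⟩ := h.exists_conflation_of_directSum hid hA (h.injObj_D hM) s
  exact ⟨N, M, n, _, hN, hM, hn⟩

/-- Injectivity passes to summands and the dimension bound to sums, so only local objects matter.
Those in `K` become zero, those in `ΩC` projective, and for the remaining ones `hΩ` applies. -/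
theorem hasProjectiveDimensionLE_one_of_injective
    (hloc : ∀ X : B, IsLocalObj X → ¬ K X → coCone E C C X)
    (hΩ : ∀ X : B, IsLocalObj X → ¬ K X → sigma E D X → ¬ omega E C X →
      ∀ (C₁ C₂ : B) (x : X ⟶ C₁) (c : C₁ ⟶ C₂), C C₁ → C C₂ → IsConflation E x c →
        ∀ ⦃S S' : B⦄ (a : S ⟶ S'), RepresentsOmega E x a → Q.map a = 0)
    (I : A) (hI : Injective I) : HasProjectiveDimensionLE I 1 := by
  obtain ⟨X, rfl⟩ := hQ.obj_surjective I
  have hz : ∀ X : B, IsZero (Q.obj X) → HasProjectiveDimensionLE (Q.obj X) 1 := fun X hX ↦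
    have := hX.hasProjectiveDimensionLT_zero
    hasProjectiveDimensionLT_of_ge _ 0 2 (by simp)
  refine hind (fun X ↦ Injective (Q.obj X) → HasProjectiveDimensionLE (Q.obj X) 1)
    (fun X hX _ ↦ hz X ?_) (fun X Y Z s hY hZ hX ↦ ?_) (fun X hX hinj ↦ ?_) X hI
  · rw [IsZero.iff_id_eq_zero, ← Q.map_id, hX.eq_of_src (𝟙 X) (0 ≫ 𝟙 X), hX.eq_of_src (0 ≫ 𝟙 X) (𝟙 X - 𝟙 X), hQ.map_sub, sub_self]
  · have := hQ.additive
    let s' : DirectSum (Q.obj X) (Q.obj Y) (Q.obj Z) :=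
      ⟨Q.map s.i, Q.map s.p, Q.map s.j, Q.map s.q, by rw [← Q.map_comp, s.i_p, Q.map_id],
        by rw [← Q.map_comp, s.j_q, Q.map_id],
        by rw [← Q.map_comp, ← Q.map_comp, ← Q.map_add, s.total, Q.map_id]⟩
    have := hY ((⟨s'.i, s'.p, s'.i_p⟩ : Retract _ _).injective)
    have := hZ ((⟨s'.j, s'.q, s'.j_q⟩ : Retract _ _).injective)
    exact hasProjectiveDimensionLT_of_iso s'.toIso.symm 2
  · by_cases hK : K X
    · exact hz X (hQ.isZero_obj hK)
    by_cases hO : omega E C X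
    · have := hQ.projective_obj_of_omega h hO
      exact (inferInstance : HasProjectiveDimensionLT (Q.obj X) (1 + 1))
    obtain ⟨C₁, C₂, x, c, hC₁, hC₂, hxc⟩ := hloc X hX hK
    obtain ⟨S₀, P₀, j₀, e₀, hP₀, h₀⟩ := h.enoughProj X
    obtain ⟨S₁, P₁, j₁, e₁, hP₁, h₁⟩ := h.enoughProj C₁
    obtain ⟨p, hp⟩ := TwinCotorsion.lift_proj h₁ hP₀ (e₀ ≫ x)
    obtain ⟨a, ha⟩ := h.lift h₁ (j₀ ≫ p) (by rw [Category.assoc, hp, h₀.zero_assoc, zero_comp])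
    exact hQ.hasProjectiveDimensionLE_one h hxc h₀ h₁ hP₁ hp ha.symm hC₁ hC₂
      (hΩ X hX hK (hQ.sigma_of_injective h hind hX hK hinj) hO C₁ C₂ x c hC₁ hC₂ hxc a
        ⟨P₀, P₁, j₀, e₀, j₁, e₁, p, hP₀, hP₁, h₀, h₁, ha.symm, hp⟩)

end IsIdealQuotientFunctor

/-- Dimension shifting along an embedding into an injective reduces this to the duality between
injective and projective objects. -/
lemma hasInjectiveDimensionLE_one_iff [EnoughInjectives A] (X : A) :
    HasInjectiveDimensionLE X 1 ↔ HasProjectiveDimensionLE (Opposite.op X) 1 := by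
  have hS : (ShortComplex.mk (Injective.ι X) _ (cokernel.condition _)).ShortExact :=
    ⟨ShortComplex.exact_cokernel _⟩
  calc HasInjectiveDimensionLT X 2
      ↔ HasInjectiveDimensionLT (cokernel (Injective.ι X)) 1 :=
        (hS.hasInjectiveDimensionLT_X₃_iff 0
          (inferInstanceAs (Injective (Injective.under X)))).symm
    _ ↔ Injective (cokernel (Injective.ι X)) := injective_iff_hasInjectiveDimensionLT_one.symm
    _ ↔ Projective (Opposite.op (cokernel (Injective.ι X))) := Injective.injective_iff_projective_op
    _ ↔ HasProjectiveDimensionLT (Opposite.op (cokernel (Injective.ι X))) 1 :=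
        projective_iff_hasProjectiveDimensionLT_one
    _ ↔ HasProjectiveDimensionLT (Opposite.op X) 2 :=
        (hS.op.hasProjectiveDimensionLT_X₃_iff 0
          (inferInstanceAs (Projective (Opposite.op (Injective.under X))))).symm

end Gorenstein

section

variable {B : Type u} [Category.{v} B] [Preadditive B]

lemma isLocalObj_of_isLocalRing {X : B} [IsLocalRing (End X)] : IsLocalObj X where
  not_isZero hX := one_ne_zero (α := End X) (hX.eq_of_src _ _)
  isIso_or f g hfg := by
    rcases IsLocalRing.isUnit_or_isUnit_of_add_one (R := End X) (a := f) (b := g) hfg with h | h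
    · exact Or.inl ((isUnit_iff_isIso f).1 h)
    · exact Or.inr ((isUnit_iff_isIso g).1 h)

end

/-! ### Consequences of the axioms of exact categories and cotorsion pairs -/

section ExactStructures

variable {B : Type u} [Category.{v} B] [Preadditive B] [HasFiniteBiproducts B]
  {E : ObjectProperty (ShortComplex B)}

namespace IsExactStructure

variable (hE : IsExactStructure E)
include hE

section

variable {A M Z : B} {i : A ⟶ M} {d : M ⟶ Z} (hid : IsConflation E i d)
include hid

lemma mono : Mono i := by
  obtain ⟨w, h⟩ := hid
  obtain ⟨hl⟩ := hE.isKernel _ h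
  exact mono_of_isLimit_fork hl

lemma epi : Epi d := by
  obtain ⟨w, h⟩ := hid
  obtain ⟨hl⟩ := hE.isCokernel _ h
  exact epi_of_isColimit_cofork hl

lemma lift {T : B} (f : T ⟶ M) (hf : f ≫ d = 0) : ∃ g : T ⟶ A, g ≫ i = f := by
  obtain ⟨w, h⟩ := hid
  obtain ⟨hl⟩ := hE.isKernel _ h
  obtain ⟨g, hg⟩ := KernelFork.IsLimit.lift' hl f hf
  exact ⟨g, hg⟩

lemma desc {T : B} (f : M ⟶ T) (hf : i ≫ f = 0) : ∃ g : Z ⟶ T, d ≫ g = f := by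
  obtain ⟨w, h⟩ := hid
  obtain ⟨hl⟩ := hE.isCokernel _ h
  obtain ⟨g, hg⟩ := CokernelCofork.IsColimit.desc' hl f hf
  exact ⟨g, hg⟩

lemma conflation_of_iso {A' M' Z' : B} {i' : A' ⟶ M'} {d' : M' ⟶ Z'} (eA : A ≅ A') (eM : M ≅ M')
    (eZ : Z ≅ Z') (h1 : eA.hom ≫ i' = i ≫ eM.hom) (h2 : eM.hom ≫ d' = d ≫ eZ.hom) :
    IsConflation E i' d' := by
  obtain ⟨w, h⟩ := hid
  have w' : i' ≫ d' = 0 := by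
    rw [← cancel_epi eA.hom, reassoc_of% h1, h2, reassoc_of% w, zero_comp, comp_zero]
  exact ⟨w', hE.of_iso (ShortComplex.isoMk eA eM eZ h1 h2) h⟩

/-- The pushed-out inflation comes with some cokernel; the universal properties identify it with
`Z`. -/
lemma exists_pushout {A' : B} (g : A ⟶ A') :
    ∃ (M' : B) (i' : A' ⟶ M') (d' : M' ⟶ Z) (g' : M ⟶ M'),
      IsConflation E i' d' ∧ i ≫ g' = g ≫ i' ∧ g' ≫ d' = d := by
  obtain ⟨M', g', i', hpo, Z₀, d₀, h₀⟩ := hE.pushout i g ⟨Z, d, hid⟩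
  have hw : i ≫ d = g ≫ (0 : A' ⟶ Z) := by rw [hid.zero, comp_zero]
  have e1 : g' ≫ hpo.desc d 0 hw = d := hpo.inl_desc _ _ _
  have e2 : i' ≫ hpo.desc d 0 hw = 0 := hpo.inr_desc _ _ _
  obtain ⟨φ, hφ⟩ := hE.desc h₀ _ e2
  obtain ⟨ψ, hψ⟩ := hE.desc hid (g' ≫ d₀) (by rw [reassoc_of% hpo.w, h₀.zero, comp_zero])
  have := hE.epi hid
  have := hE.epi h₀
  refine ⟨M', i', hpo.desc d 0 hw, g', hE.conflation_of_iso h₀ (Iso.refl _) (Iso.refl _)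
    ⟨φ, ψ, ?_, ?_⟩ (by simp) (by simp [hφ]), hpo.w, e1⟩
  · rw [← cancel_epi d₀, reassoc_of% hφ, Category.comp_id]
    apply hpo.hom_ext
    · rw [reassoc_of% e1, hψ]
    · rw [reassoc_of% e2, zero_comp, h₀.zero]
  · rw [← cancel_epi d, reassoc_of% hψ, hφ, e1, Category.comp_id]

lemma exists_pullback {Z' : B} (g : Z' ⟶ Z) :
    ∃ (M' : B) (i' : A ⟶ M') (d' : M' ⟶ Z') (g' : M' ⟶ M),
      IsConflation E i' d' ∧ g' ≫ d = d' ≫ g ∧ i' ≫ g' = i := by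
  obtain ⟨M', g', d', hpb, A₀, i₀, h₀⟩ := hE.pullback d g ⟨A, i, hid⟩
  have hw : i ≫ d = (0 : A ⟶ Z') ≫ g := by rw [hid.zero, zero_comp]
  have e1 : hpb.lift i 0 hw ≫ g' = i := hpb.lift_fst _ _ _
  have e2 : hpb.lift i 0 hw ≫ d' = 0 := hpb.lift_snd _ _ _
  obtain ⟨φ, hφ⟩ := hE.lift h₀ _ e2
  obtain ⟨ψ, hψ⟩ := hE.lift hid (i₀ ≫ g') (by
    rw [Category.assoc, hpb.w, h₀.zero_assoc, zero_comp])
  have := hE.mono hid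
  have := hE.mono h₀
  refine ⟨M', hpb.lift i 0 hw, d', g', hE.conflation_of_iso h₀
    ⟨ψ, φ, ?_, ?_⟩ (Iso.refl _) (Iso.refl _) ?_ (by simp), hpb.w, e1⟩
  · rw [← cancel_mono i₀, Category.assoc, hφ, Category.id_comp]
    apply hpb.hom_ext
    · rw [Category.assoc, e1, hψ]
    · rw [Category.assoc, e2, comp_zero, h₀.zero]
  · rw [← cancel_mono i, Category.assoc, hψ, reassoc_of% hφ, e1, Category.id_comp]
  · apply hpb.hom_ext
    · simp [e1, hψ]
    · simp [e2, h₀.zero]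

lemma retraction_of_section {s : Z ⟶ M} (hs : s ≫ d = 𝟙 Z) : ∃ r : M ⟶ A, i ≫ r = 𝟙 A := by
  obtain ⟨r, hr⟩ := hE.lift hid (𝟙 M - d ≫ s) (by simp [hs])
  have := hE.mono hid
  exact ⟨r, by rw [← cancel_mono i, Category.assoc, hr]; simp [hid.zero_assoc]⟩

lemma nonempty_directSum {r : M ⟶ A} (hr : i ≫ r = 𝟙 A) : Nonempty (DirectSum M A Z) := by
  obtain ⟨s, hs⟩ := hE.desc hid (𝟙 M - r ≫ i) (by simp [reassoc_of% hr])
  have := hE.epi hid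
  exact ⟨⟨i, r, s, d, hr, by rw [← cancel_epi d, reassoc_of% hs]; simp [hid.zero], by simp [hs]⟩⟩

end

/-- The cokernel of an identity is zero. Pulling its conflation back along `Z ⟶ 0` gives a split
conflation, which is then identified with the given decomposition. -/
lemma conflation_of_directSum {X Y Z : B} (s : DirectSum X Y Z) : IsConflation E s.i s.q := by
  obtain ⟨Z₀, d₀, h₀⟩ := hE.id_inflation Y
  obtain ⟨M, i, d, r, h, -, hr⟩ := hE.exists_pullback h₀ (0 : Z ⟶ Z₀)
  obtain ⟨σ, hσ⟩ := hE.desc h (𝟙 M - r ≫ i) (by simp [reassoc_of% hr])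
  have := hE.epi h
  have hσd : σ ≫ d = 𝟙 Z := by rw [← cancel_epi d, reassoc_of% hσ]; simp [h.zero]
  have hσr : σ ≫ r = 0 := by rw [← cancel_epi d, reassoc_of% hσ]; simp [hr]
  refine hE.conflation_of_iso h (Iso.refl _)
    ⟨r ≫ s.i + d ≫ s.j, s.p ≫ i + s.q ≫ σ, ?_, ?_⟩ (Iso.refl _) ?_ ?_
  · simp [hσ]
  · simp [reassoc_of% hr, h.zero_assoc, reassoc_of% hσr, reassoc_of% hσd, s.total]
  · simp [reassoc_of% hr, h.zero_assoc]
  · simp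

lemma coCone_of_iso {P R : ObjectProperty B} {X Y : B} (e : X ≅ Y) (hX : coCone E P R X) :
    coCone E P R Y := by
  obtain ⟨M, Z, i, d, hM, hZ, h⟩ := hX
  exact ⟨M, Z, e.inv ≫ i, d, hM, hZ,
    hE.conflation_of_iso h e (Iso.refl _) (Iso.refl _) (by simp) (by simp)⟩

lemma cone_of_iso {P R : ObjectProperty B} {X Y : B} (e : X ≅ Y) (hX : cone E P R X) :
    cone E P R Y := by
  obtain ⟨A, M, i, d, hA, hM, h⟩ := hX
  exact ⟨A, M, i, d ≫ e.hom, hA, hM,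
    hE.conflation_of_iso h (Iso.refl _) (Iso.refl _) e (by simp) (by simp)⟩

end IsExactStructure

attribute [local instance] hasBinaryBiproducts_of_finite_biproducts

namespace IsCotorsionPair

variable (hE : IsExactStructure E) {U V : ObjectProperty B} (h : IsCotorsionPair E U V)
include h

lemma left_of_directSum {X Y Z : B} (s : DirectSum X Y Z) (hX : U X) : U Y :=
  h.left_summands X Y Z ⟨s.toIso⟩ hX

lemma right_of_directSum {X Y Z : B} (s : DirectSum X Y Z) (hX : V X) : V Y :=
  h.right_summands X Y Z ⟨s.toIso⟩ hX

include hE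

lemma exists_retraction {A M Z : B} {i : A ⟶ M} {d : M ⟶ Z} (hid : IsConflation E i d) (hZ : U Z)
    (hA : V A) : ∃ r : M ⟶ A, i ≫ r = 𝟙 A := by
  obtain ⟨s, hs⟩ := h.ext_vanish i d hZ hA hid
  exact hE.retraction_of_section hid hs

/-- `V` is the full Ext-orthogonal of `U`: the coresolution of `X` splits, making `X` a summand of
an object of `V`. -/
lemma right_of_exists_retraction {X : B}
    (hX : ∀ {M Z : B} {i : X ⟶ M} {d : M ⟶ Z}, IsConflation E i d → U Z →
      ∃ r : M ⟶ X, i ≫ r = 𝟙 X) : V X := by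
  obtain ⟨M, Z, i, d, hM, hZ, hid⟩ := h.mem_coCone X
  obtain ⟨r, hr⟩ := hX hid hZ
  obtain ⟨s⟩ := hE.nonempty_directSum hid hr
  exact h.right_of_directSum s hM

lemma left_of_exists_section {X : B}
    (hX : ∀ {A M : B} {i : A ⟶ M} {d : M ⟶ X}, IsConflation E i d → V A →
      ∃ s : X ⟶ M, s ≫ d = 𝟙 X) : U X := by
  obtain ⟨A, M, i, d, hA, hM, hid⟩ := h.mem_cone X
  obtain ⟨s, hs⟩ := hX hid hA
  obtain ⟨r, hr⟩ := hE.retraction_of_section hid hs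
  obtain ⟨t⟩ := hE.nonempty_directSum hid hr
  exact h.left_of_directSum t.symm hM

lemma extend {A M Z T : B} {i : A ⟶ M} {d : M ⟶ Z} (hid : IsConflation E i d) (hZ : U Z)
    (hT : V T) (f : A ⟶ T) : ∃ g : M ⟶ T, i ≫ g = f := by
  obtain ⟨M', i', d', f', hid', h1, -⟩ := hE.exists_pushout hid f
  obtain ⟨r, hr⟩ := h.exists_retraction hE hid' hZ hT
  exact ⟨f' ≫ r, by rw [reassoc_of% h1, hr, Category.comp_id]⟩

lemma lift {A M Z T : B} {i : A ⟶ M} {d : M ⟶ Z} (hid : IsConflation E i d) (hA : V A)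
    (hT : U T) (f : T ⟶ Z) : ∃ g : T ⟶ M, g ≫ d = f := by
  obtain ⟨M', i', d', f', hid', h1, -⟩ := hE.exists_pullback hid f
  obtain ⟨s, hs⟩ := h.ext_vanish i' d' hT hA hid'
  exact ⟨s ≫ f', by rw [Category.assoc, h1, reassoc_of% hs]⟩

lemma right_of_retract {X Y : B} (i : Y ⟶ X) (p : X ⟶ Y) (hip : i ≫ p = 𝟙 Y) (hX : V X) : V Y :=
  h.right_of_exists_retraction hE fun hjd hZ ↦ by
    obtain ⟨g, hg⟩ := h.extend hE hjd hZ hX i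
    exact ⟨g ≫ p, by rw [reassoc_of% hg, hip]⟩

lemma right_directSum {X Y Z : B} (s : DirectSum X Y Z) (hY : V Y) (hZ : V Z) : V X :=
  h.right_of_exists_retraction hE fun hjd hW ↦ by
    obtain ⟨g, hg⟩ := h.extend hE hjd hW hY s.p
    obtain ⟨g', hg'⟩ := h.extend hE hjd hW hZ s.q
    exact ⟨g ≫ s.i + g' ≫ s.j, by simp [reassoc_of% hg, reassoc_of% hg', s.total]⟩

lemma left_directSum {X Y Z : B} (s : DirectSum X Y Z) (hY : U Y) (hZ : U Z) : U X :=
  h.left_of_exists_section hE fun hjd hA ↦ by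
    obtain ⟨g, hg⟩ := h.lift hE hjd hA hY s.i
    obtain ⟨g', hg'⟩ := h.lift hE hjd hA hZ s.j
    exact ⟨s.p ≫ g + s.q ≫ g', by simp [hg, hg', s.total]⟩

lemma right_of_isZero {X : B} (hX : IsZero X) : V X :=
  h.right_of_exists_retraction hE fun _ _ ↦ ⟨0, hX.eq_of_src _ _⟩

lemma left_of_projObj {P : B} (hP : projObj E P) : U P :=
  h.left_of_exists_section hE fun hid _ ↦ hP _ ⟨_, _, hid⟩ (𝟙 P)

lemma right_of_injObj {I : B} (hI : injObj E I) : V I :=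
  h.right_of_exists_retraction hE fun hid _ ↦ hI _ ⟨_, _, hid⟩ (𝟙 I)

end IsCotorsionPair

section KrullSchmidt

lemma IsKrullSchmidt.localInduction (hKS : IsKrullSchmidt B) : LocalInduction B := by
  intro Φ h0 hs hl X
  have key : ∀ (n : ℕ) (Y : Fin n → B), (∀ j, Φ (Y j)) → Φ (⨁ Y) := by
    intro n
    induction n with
    | zero =>
      intro Y _
      apply h0
      rw [IsZero.iff_id_eq_zero, ← biproduct.total]
      simp
    | succ n ih =>
      intro Y hY
      refine hs _ _ _ ?_ (hY 0) (ih (fun j ↦ Y j.succ) fun j ↦ hY _)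
      refine ⟨biproduct.ι Y 0, biproduct.π Y 0, biproduct.desc fun j ↦ biproduct.ι Y j.succ,
        biproduct.lift fun j ↦ biproduct.π Y j.succ, by simp, ?_, ?_⟩
      · ext j j'
        by_cases hj : j = j'
        · subst hj
          simp
        · simp [biproduct.ι_π_ne (fun j : Fin n ↦ Y j.succ) (Ne.symm hj),
            biproduct.ι_π_ne Y (fun h ↦ hj (Fin.succ_injective n h.symm))]
      · rw [biproduct.lift_desc, ← biproduct.total, Fin.sum_univ_succ]
  obtain ⟨n, Y, hY, ⟨e⟩⟩ := hKS X
  -- `Φ` is not assumed invariant under isomorphism, so `X` is presented as the direct sum of `⨁ Y`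
  -- and an empty sum.
  exact hs X (⨁ Y) (⨁ (Fin.elim0 : Fin 0 → B))
    ⟨e.inv, e.hom, 0, 0, by simp, by
      rw [← biproduct.total]
      simp, by simp⟩
    (key n Y fun j ↦ have := hY j; hl _ isLocalObj_of_isLocalRing)
    (key 0 _ fun j ↦ j.elim0)

end KrullSchmidt

end ExactStructures

/-! ### Quasi-regularity for objects without summands in `K` -/

section Radicals

variable {B : Type u} [Category.{v} B] [Preadditive B]

/-- Jacobson's identity: if `c` is inverse to `1 - ba`, then `1 + acb` is inverse to `1 - ab`. -/
lemma isIso_one_sub_comp {X Y : B} (a : X ⟶ Y) (b : Y ⟶ X) (h : IsIso (𝟙 Y - b ≫ a)) :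
    IsIso (𝟙 X - a ≫ b) := by
  obtain ⟨c, e2, e1⟩ := h.out
  rw [Preadditive.comp_sub, Category.comp_id, sub_eq_iff_eq_add] at e1
  rw [Preadditive.sub_comp, Category.id_comp, sub_eq_iff_eq_add, Category.assoc] at e2
  refine ⟨𝟙 X + a ≫ c ≫ b, ?_, ?_⟩
  · have := congrArg (fun t ↦ a ≫ t ≫ b) e2
    simp only [Preadditive.add_comp, Preadditive.comp_add, Category.assoc, Category.id_comp] at this
    simp only [Preadditive.sub_comp, Preadditive.comp_add, Category.assoc, Category.comp_id,
      Category.id_comp]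
    refine Eq.trans ?_ (add_zero (𝟙 X))
    rw [← sub_eq_zero.2 this]
    abel
  · have := congrArg (fun t ↦ a ≫ t ≫ b) e1
    simp only [Preadditive.add_comp, Preadditive.comp_add, Category.assoc, Category.id_comp] at this
    simp only [Preadditive.comp_sub, Preadditive.add_comp, Category.assoc, Category.comp_id,
      Category.id_comp]
    refine Eq.trans ?_ (add_zero (𝟙 X))
    rw [← sub_eq_zero.2 this]
    abel

variable {K : ObjectProperty B}

/-- Removing the `Y`-component of `f` first, with inverse `g`, factors `𝟙 X - f` into two maps, each
invertible by moving the product to one summand. -/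
lemma IsRadical.directSum {X Y Z : B} (s : DirectSum X Y Z) (hY : IsRadical K Y)
    (hZ : IsRadical K Z) : IsRadical K X := by
  rintro f ⟨W, a, b, hW, hab⟩
  have h1 : IsIso (𝟙 X - (f ≫ s.p) ≫ s.i) :=
    isIso_one_sub_comp _ _ (hY _ ⟨W, s.i ≫ a, b ≫ s.p, hW, by simp [← hab]⟩)
  obtain ⟨g, -, hg⟩ := h1.out
  have h2 : IsIso (𝟙 X - (f ≫ s.q) ≫ s.j ≫ g) :=
    isIso_one_sub_comp _ _ (hZ _ ⟨W, s.j ≫ g ≫ a, b ≫ s.q, hW, by simp [← hab]⟩)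
  have ht : f ≫ s.p ≫ s.i + f ≫ s.q ≫ s.j = f := by
    rw [← Preadditive.comp_add, s.total, Category.comp_id]
  have e : 𝟙 X - f = (𝟙 X - (f ≫ s.q) ≫ s.j ≫ g) ≫ (𝟙 X - (f ≫ s.p) ≫ s.i) := by
    rw [Preadditive.sub_comp, Category.id_comp, Category.assoc (f ≫ s.q), Category.assoc s.j, hg,
      Category.comp_id, Category.assoc, Category.assoc, sub_sub, ht]
  rw [e]
  infer_instance

lemma IsLocalObj.isZero_or {X Y Z : B} (hX : IsLocalObj X) (s : DirectSum X Y Z) :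
    IsZero Y ∨ IsZero Z := by
  rcases hX.isIso_or _ _ s.total with h | h
  · right
    have : s.j = 0 := by rw [← cancel_mono (s.p ≫ s.i), zero_comp, s.j_p_assoc, zero_comp]
    rw [IsZero.iff_id_eq_zero, ← s.j_q, this, zero_comp]
  · left
    have : s.i = 0 := by rw [← cancel_mono (s.q ≫ s.j), zero_comp, s.i_q_assoc, zero_comp]
    rw [IsZero.iff_id_eq_zero, ← s.i_p, this, zero_comp]

def DirectSum.isoOfIsZero {X Y Z : B} (s : DirectSum X Y Z) (hZ : IsZero Z) : Y ≅ X :=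
  ⟨s.i, s.p, s.i_p, by
    have := s.total
    rwa [hZ.eq_zero_of_src s.j, comp_zero, add_zero] at this⟩

attribute [local instance] hasBinaryBiproducts_of_finite_biproducts

variable [HasFiniteBiproducts B]

/-- The absence of summands in `K` passes to direct summands and quasi-regularity passes back to
sums, so the claim reduces to local objects. -/
lemma LocalInduction.isRadical {E : ObjectProperty (ShortComplex B)} {C D : ObjectProperty B}
    (hind : LocalInduction B) (h : TwinCotorsion E C K D) [HasZeroObject B] (X : B) :
    (∀ Y Z : B, DirectSum X Y Z → K Y → IsZero Y) → IsRadical K X := by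
  refine hind (fun X ↦ (∀ Y Z : B, DirectSum X Y Z → K Y → IsZero Y) → IsRadical K X)
    (fun X hX _ f _ ↦ ?_) (fun X Y Z s hY hZ hX ↦ ?_) (fun X hX hs ↦ ?_) X
  · rw [hX.eq_of_src (𝟙 X - f) (𝟙 X)]
    infer_instance
  · have key : ∀ {Y Z : B}, DirectSum X Y Z → ∀ Y' Z' : B, DirectSum Y Y' Z' → K Y' → IsZero Y' :=
      fun {Y Z} s Y' Z' t hY' ↦ by
        refine hX Y' (Z' ⊞ Z) ⟨t.i ≫ s.i, s.p ≫ t.p, biprod.desc (t.j ≫ s.i) s.j,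
          biprod.lift (s.p ≫ t.q) s.q, by simp, by ext <;> simp, ?_⟩ hY'
        have := congrArg (fun r ↦ s.p ≫ r ≫ s.i) t.total
        simp only [Preadditive.add_comp, Preadditive.comp_add, Category.assoc,
          Category.id_comp] at this
        rw [biprod.lift_desc, ← s.total, ← this]
        simp only [Category.assoc]
        abel
    exact (hY (key s)).directSum s (hZ (key s.symm))
  · refine h.isRadical_of_isLocalObj hX fun hK ↦ hX.not_isZero ?_
    obtain ⟨Z, hZ⟩ := HasZeroObject.zero (C := B)
    exact hs X Z ⟨𝟙 X, 𝟙 X, 0, 0, by simp, hZ.eq_of_src _ _, by simp⟩ hK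

end Radicals

/-! ### Fully rigid cotorsion pairs and the Gorenstein criterion -/

section FullyRigid

variable {B : Type u} [Category.{v} B] [Preadditive B] [HasFiniteBiproducts B]
  {E : ObjectProperty (ShortComplex B)} {C K D : ObjectProperty B}

attribute [local instance] hasBinaryBiproducts_of_finite_biproducts

lemma IsLocalObj.indecomposable {X : B} (hX : IsLocalObj X) : Indecomposable X :=
  ⟨hX.not_isZero, fun _ _ e ↦ hX.isZero_or (DirectSum.ofIso e)⟩

lemma IsFullyRigid.le (hE : IsExactStructure E) (hCK : IsFullyRigid E C K) {X : B} (hX : C X) :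
    K X :=
  hCK.cotorsion.right_of_exists_retraction hE fun {_ _ i d} hid hZ ↦ by
    obtain ⟨s, hs⟩ := hCK.rigid i d hZ hX hid
    exact hE.retraction_of_section hid hs

lemma IsFullyRigid.coCone_of_isLocalObj (hCK : IsFullyRigid E C K) {X : B} (hX : IsLocalObj X)
    (hK : ¬ K X) : coCone E C C X := by
  obtain ⟨-, M, Z, i, d, hM, hZ, hid⟩ :=
    (hCK.indecomposable_mem X hX.indecomposable).resolve_left hK
  exact ⟨M, Z, i, d, hM.1, hZ, hid⟩

/-- For a local object of `D` outside `K`, the sequence `X ↣ M ↠ Z` with terms in `C` would split,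
since `Z` is in `K`. Then `X` would be a retract of `M`, which lies in `K`. -/
lemma IsFullyRigid.le_of_isCotorsionPair (hE : IsExactStructure E) (hKS : IsKrullSchmidt B)
    (hCK : IsFullyRigid E C K) (hKD : IsCotorsionPair E K D) (X : B) : D X → K X := by
  refine hKS.localInduction (fun X ↦ D X → K X)
    (fun X hX _ ↦ hCK.cotorsion.right_of_isZero hE hX) (fun X Y Z s hY hZ hX ↦ ?_)
    (fun X hX hD ↦ ?_) X
  · exact hCK.cotorsion.right_directSum hE s (hY (hKD.right_of_directSum s hX))
      (hZ (hKD.right_of_directSum s.symm hX))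
  · by_contra hK
    obtain ⟨M, Z, i, d, hM, hZ, hid⟩ := hCK.coCone_of_isLocalObj hX hK
    obtain ⟨r, hr⟩ := hKD.exists_retraction hE hid (hCK.le hE hZ) hD
    exact hK (hCK.cotorsion.right_of_retract hE i r hr (hCK.le hE hM))

lemma IsFullyRigid.rigidTwinCotorsion (hE : IsExactStructure E) (hKS : IsKrullSchmidt B)
    (hP : HasEnoughProj E) (hI : HasEnoughInj E) (hCK : IsFullyRigid E C K)
    (hKD : IsCotorsionPair E K D) : RigidTwinCotorsion E C K D where
  mono := hE.mono
  epi := hE.epi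
  lift hid f hf := hE.lift hid f hf
  desc hid f hf := hE.desc hid f hf
  pushout hid g := hE.exists_pushout hid g
  pullback hid f := hE.exists_pullback hid f
  deflation_comp hid s :=
    hE.comp_deflation _ _ ⟨_, _, hid⟩ ⟨_, _, hE.conflation_of_directSum s.symm⟩
  inflation_comp hid s :=
    hE.comp_inflation _ _ ⟨_, _, hE.conflation_of_directSum s⟩ ⟨_, _, hid⟩
  extCK := hCK.cotorsion.exists_retraction hE
  extKD hid hZ hA := hKD.ext_vanish _ _ hZ hA hid
  resC := hCK.cotorsion.mem_cone
  coresK := hCK.cotorsion.mem_coCone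
  resK := hKD.mem_cone
  coresD := hKD.mem_coCone
  enoughProj X := by
    obtain ⟨P, d, hP, A, i, hid⟩ := hP X
    exact ⟨A, P, i, d, hP, hid⟩
  enoughInj X := by
    obtain ⟨I, i, hI, Z, d, hid⟩ := hI X
    exact ⟨I, Z, i, d, hI, hid⟩
  projObj_C := hCK.cotorsion.left_of_projObj hE
  projObj_K hP := hCK.le hE (hCK.cotorsion.left_of_projObj hE hP)
  injObj_D := hKD.right_of_injObj hE
  injObj_K hI := hCK.le_of_isCotorsionPair hE hKS hKD _ (hKD.right_of_injObj hE hI)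
  summand_C := hCK.cotorsion.left_of_directSum
  summand_D := hKD.right_of_directSum
  sum_C := hCK.cotorsion.left_directSum hE
  sum_K := hCK.cotorsion.right_directSum hE
  sum_D := hKD.right_directSum hE
  retract_K := hCK.cotorsion.right_of_retract hE
  C_K := hCK.le hE
  D_K := hCK.le_of_isCotorsionPair hE hKS hKD _

lemma withoutSummand_of_isLocalObj {W R : ObjectProperty B} {X : B} (hX : IsLocalObj X)
    (hW : W X) (hR : ∀ Y : B, (Y ≅ X) → ¬ R Y) : withoutSummand W R X := by
  refine ⟨hW, fun Y Z ⟨e⟩ hY ↦ ?_⟩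
  exact (hX.isZero_or (DirectSum.ofIso e)).resolve_right fun hZ ↦
    hR Y ((DirectSum.ofIso e).isoOfIsZero hZ) hY

section

variable {A : Type u} [Category.{v} A] [Abelian A] {Q : B ⥤ A}

theorem isOneGorenstein_iff (hQ : IsIdealQuotientFunctor Q K) (hE : IsExactStructure E)
    (hKS : IsKrullSchmidt B) (hP : HasEnoughProj E) (hI : HasEnoughInj E)
    (hCK : IsFullyRigid E C K) (hKD : IsCotorsionPair E K D) :
    IsOneGorenstein A ↔
      (∀ X : B, withoutSummand (sigma E D) (omega E C) X → withoutSummand (heartObj E C K) K X →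
        ∀ (C₁ C₂ : B) (x : X ⟶ C₁) (c : C₁ ⟶ C₂), C C₁ → C C₂ → IsConflation E x c →
          ∀ ⦃S S' : B⦄ (a : S ⟶ S'), RepresentsOmega E x a → Q.map a = 0) ∧
      (∀ Y : B, withoutSummand (omega E C) (sigma E D) Y → withoutSummand (heartObj E C K) K Y →
        ∀ (D₁ D₂ : B) (d : D₂ ⟶ D₁) (y : D₁ ⟶ Y), D D₁ → D D₂ → IsConflation E d y →
          ∀ ⦃Z Z' : B⦄ (b : Z ⟶ Z'), RepresentsSigma E y b → Q.map b = 0) := by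
  have h := hCK.rigidTwinCotorsion hE hKS hP hI hKD
  have hind := hKS.localInduction
  have hzero : HasZeroObject B := inferInstance
  have hrad : ∀ X : B, withoutSummand (heartObj E C K) K X → IsRadical K X := fun X hX ↦
    hind.isRadical h.toTwinCotorsion X fun Y Z s hY ↦ hX.2 Y Z ⟨s.toIso⟩ hY
  have hheart : ∀ X : B, IsLocalObj X → ¬ K X → withoutSummand (heartObj E C K) K X :=
    fun X hX hK ↦ withoutSummand_of_isLocalObj hX
      ((hCK.indecomposable_mem X hX.indecomposable).resolve_left hK)
      fun Y e hY ↦ hK (h.retract_K e.inv e.hom e.inv_hom_id hY)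
  have := hQ.enoughProjectives h
  have := hQ.enoughInjectives h
  constructor
  · refine fun hG ↦ ⟨?_, ?_⟩
    · rintro X hX hX' C₁ C₂ x c hC₁ hC₂ hxc S S' a ⟨P, P', i, e, i', e', p, hP, hP', h₀, h₁, hip, hp⟩
      exact hQ.map_omega_eq_zero h hxc h₀ h₁ hP' hp hip hC₁ hC₂ hP (hrad X hX')
        (hG.projectiveDimension_le _ (hQ.injective_obj_of_sigma h hX.1))
    · rintro Y hY hY' D₁ D₂ d y hD₁ hD₂ hdy Z Z' b ⟨I, I', i, e, i', e', q, hI, hI', h₀, h₁, hiq, hq⟩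
      have hpd := (hasInjectiveDimensionLE_one_iff _).1
        (hG.injectiveDimension_le _ (hQ.projective_obj_of_omega h hY.1))
      exact congrArg Quiver.Hom.unop (hQ.op.map_omega_eq_zero h.op hdy.op h₁.op h₀.op
        (projObj_opClass.2 hI) (congrArg Quiver.Hom.op hiq) (congrArg Quiver.Hom.op hq) hD₁ hD₂
        (projObj_opClass.2 hI') (hrad Y hY').op hpd)
  · rintro ⟨ha, hb⟩
    refine ⟨inferInstance, inferInstance, fun I hI ↦ ?_, fun P hP ↦ ?_⟩
    · refine hQ.hasProjectiveDimensionLE_one_of_injective h hind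
        (fun X hX hK ↦ hCK.coCone_of_isLocalObj hX hK) (fun X hX hK hs ho ↦ ha X ?_ ?_) I hI
      · exact withoutSummand_of_isLocalObj hX hs fun Y e hY ↦ ho (hE.coCone_of_iso e hY)
      · exact hheart X hX hK
    · rw [hasInjectiveDimensionLE_one_iff]
      -- In the opposite category the sequences with terms in `C` become sequences with terms in
      -- `D`, which exist by `cone_of_isLocalObj`.
      refine hQ.op.hasProjectiveDimensionLE_one_of_injective h.op hind.op
        (fun X hX hK ↦ coCone_opClass.2 (hQ.cone_of_isLocalObj h hind hX.unop hK))
        (fun X hX hK hs ho ↦ ?_) _ inferInstance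
      rintro D₁ D₂ y d hD₁ hD₂ hyd S S' b ⟨I', I, i', e', i, e, q, hI', hI, h₁, h₀, hiq, hq⟩
      refine congrArg Quiver.Hom.op (hb X.unop ?_ (hheart _ hX.unop hK) D₁.unop D₂.unop d.unop
        y.unop hD₁ hD₂ hyd.unop b.unop ⟨I.unop, I'.unop, e.unop, i.unop, e'.unop, i'.unop, q.unop,
          projObj_opClass.1 hI, projObj_opClass.1 hI', h₀.unop, h₁.unop,
          congrArg Quiver.Hom.unop hq, congrArg Quiver.Hom.unop hiq⟩)
      exact withoutSummand_of_isLocalObj hX.unop (sigma_opClass.1 hs)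
        fun Y e hY ↦ ho (omega_opClass.2 (hE.cone_of_iso e hY))

end

/-! ### The concrete quotient category `B / K` -/

section IdealQuotient

lemma coCone_directSum (hE : IsExactStructure E) (h : RigidTwinCotorsion E C K D) {Y Z : B}
    (hY : coCone E C C Y) (hZ : coCone E C C Z) : coCone E C C (Y ⊞ Z) := by
  obtain ⟨M, N, i, d, hM, hN, hid⟩ := hY
  obtain ⟨M', N', i', d', hM', hN', hid'⟩ := hZ
  exact ⟨M ⊞ M', N ⊞ N', biprod.map i i', biprod.map d d',
    h.sum_C (DirectSum.ofIso (Iso.refl _)) hM hM', h.sum_C (DirectSum.ofIso (Iso.refl _)) hN hN',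
    (hE.biprod_iff i d i' d').2 ⟨hid, hid'⟩⟩

lemma coCone_of_isZero (hE : IsExactStructure E) (h : RigidTwinCotorsion E C K D) {X : B}
    (hX : IsZero X) : coCone E C C X := by
  obtain ⟨Z, d, hd⟩ := hE.id_inflation X
  have := hE.epi hd
  exact ⟨X, Z, 𝟙 X, d, h.C_of_isZero hX, h.C_of_isZero (hX.of_epi d), hd⟩

section

variable {A : Type*} [Category* A] [Preadditive A] {Q : B ⥤ A}

/-- The image of a direct sum decomposition under an additive functor. -/
def DirectSum.map (Q : B ⥤ A) [Q.Additive] {X Y Z : B} (s : DirectSum X Y Z) :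
    DirectSum (Q.obj X) (Q.obj Y) (Q.obj Z) where
  i := Q.map s.i
  p := Q.map s.p
  j := Q.map s.j
  q := Q.map s.q
  i_p := by rw [← Q.map_comp, s.i_p, Q.map_id]
  j_q := by rw [← Q.map_comp, s.j_q, Q.map_id]
  total := by rw [← Q.map_comp, ← Q.map_comp, ← Q.map_add, s.total, Q.map_id]

namespace IsIdealQuotientFunctor

variable (hQ : IsIdealQuotientFunctor Q K) (h : RigidTwinCotorsion E C K D)
include hQ h

lemma hasFiniteProducts : HasFiniteProducts A := by
  have := hQ.additive
  have : HasBinaryBiproducts A := ⟨fun X Y ↦ by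
    obtain ⟨X, rfl⟩ := hQ.obj_surjective X
    obtain ⟨Y, rfl⟩ := hQ.obj_surjective Y
    let s := (DirectSum.ofIso (Iso.refl (X ⊞ Y))).map Q
    exact hasBinaryBiproduct_of_total
      { pt := Q.obj (X ⊞ Y)
        fst := s.p
        snd := s.q
        inl := s.i
        inr := s.j
        inl_fst := s.i_p
        inl_snd := s.i_q
        inr_fst := s.j_p
        inr_snd := s.j_q } s.total⟩
  have : HasZeroObject A := by
    obtain ⟨Z, hZ⟩ := HasZeroObject.zero (C := B)
    exact ⟨Q.obj Z, hQ.isZero_obj (h.K_of_isZero hZ)⟩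
  exact hasFiniteProducts_of_has_binary_and_terminal

/-- Only the class in the quotient matters, so summands in `K` may be replaced by zero; the other
local summands have the required sequences. -/
lemma exists_coCone_iso (hE : IsExactStructure E) (hind : LocalInduction B)
    (hloc : ∀ X : B, IsLocalObj X → ¬ K X → coCone E C C X) (X : A) :
    ∃ Y : B, coCone E C C Y ∧ Nonempty (Q.obj Y ≅ X) := by
  obtain ⟨X, rfl⟩ := hQ.obj_surjective X
  have := hQ.additive
  have := hQ.hasFiniteProducts h
  have : HasBinaryBiproducts A := HasBinaryBiproducts.of_hasBinaryProducts
  have hK : ∀ X : B, K X → ∃ Y : B, coCone E C C Y ∧ Nonempty (Q.obj Y ≅ Q.obj X) := fun X hX ↦ by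
    obtain ⟨Z, hZ⟩ := HasZeroObject.zero (C := B)
    exact ⟨Z, coCone_of_isZero hE h hZ,
      ⟨(hQ.isZero_obj (h.K_of_isZero hZ)).iso (hQ.isZero_obj hX)⟩⟩
  refine hind (fun X ↦ ∃ Y : B, coCone E C C Y ∧ Nonempty (Q.obj Y ≅ Q.obj X))
    (fun X hX ↦ hK X (h.K_of_isZero hX)) (fun X Y Z s hY hZ ↦ ?_) (fun X hX ↦ ?_) X
  · obtain ⟨Y', hY', ⟨eY⟩⟩ := hY
    obtain ⟨Z', hZ', ⟨eZ⟩⟩ := hZ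
    exact ⟨Y' ⊞ Z', coCone_directSum hE h hY' hZ',
      ⟨((DirectSum.ofIso (Iso.refl (Y' ⊞ Z'))).map Q).toIso ≪≫ biprod.mapIso eY eZ ≪≫
        (s.map Q).toIso.symm⟩⟩
  · by_cases hX' : K X
    · exact hK X hX'
    · exact ⟨X, hloc X hX hX', ⟨Iso.refl _⟩⟩

end IsIdealQuotientFunctor

end

section

variable (h : RigidTwinCotorsion E C K D)
include h

lemma factorRel_add ⦃X Y : B⦄ (f₁ f₂ g₁ g₂ : X ⟶ Y) (hf : factorRel K f₁ f₂)
    (hg : factorRel K g₁ g₂) : factorRel K (f₁ + g₁) (f₂ + g₂) := by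
  obtain ⟨Z, a, b, hZ, hab⟩ := hf
  obtain ⟨Z', a', b', hZ', hab'⟩ := hg
  refine ⟨Z ⊞ Z', biprod.lift a a', biprod.desc b b',
    h.sum_K (DirectSum.ofIso (Iso.refl _)) hZ hZ', ?_⟩
  rw [biprod.lift_desc, ← hab, ← hab']
  abel

lemma congruence_factorRel : Congruence (factorRel K) where
  equivalence {X Y} :=
    { refl f := by
        obtain ⟨Z, hZ⟩ := HasZeroObject.zero (C := B)
        exact ⟨Z, 0, 0, h.K_of_isZero hZ, by simp⟩
      symm := by
        rintro f g ⟨Z, a, b, hZ, hab⟩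
        exact ⟨Z, -a, b, hZ, by rw [Preadditive.neg_comp, ← hab, neg_sub]⟩
      trans := by
        rintro f g l hfg hgl
        obtain ⟨Z, a, b, hZ, hab⟩ := factorRel_add h _ _ _ _ hfg hgl
        exact ⟨Z, a, b, hZ, by rw [← hab]; abel⟩ }
  comp_left f := by
    rintro g g' ⟨Z, a, b, hZ, hab⟩
    exact ⟨Z, f ≫ a, b, hZ, by rw [← Preadditive.comp_sub, hab, Category.assoc]⟩
  comp_right g := by
    rintro ⟨Z, a, b, hZ, hab⟩
    exact ⟨Z, a, b ≫ g, hZ, by rw [← Preadditive.sub_comp, hab, Category.assoc]⟩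

/-- The preadditive structure of `B / K`. -/
noncomputable abbrev idealQuotientPreadditive : Preadditive (IdealQuotient K) :=
  have := congruence_factorRel h
  Quotient.preadditive _ (factorRel_add h)

lemma isIdealQuotientFunctor_functor :
    letI := idealQuotientPreadditive h
    IsIdealQuotientFunctor (Quotient.functor (factorRel K)) K :=
  letI := idealQuotientPreadditive h
  have := congruence_factorRel h
  have hadd : (Quotient.functor (factorRel K)).Additive :=
    Quotient.functor_additive _ (factorRel_add h)
  { additive := hadd
    obj_surjective := fun X ↦ ⟨X.as, rfl⟩
    full := inferInstance
    map_eq_zero_iff := fun {X Y f} ↦ by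
      rw [← (Quotient.functor (factorRel K)).map_zero, Quotient.functor_map_eq_iff]
      constructor
      · rintro ⟨Z, a, b, hZ, hab⟩
        exact ⟨Z, a, b, hZ, by rw [← hab, sub_zero]⟩
      · rintro ⟨Z, a, b, hZ, hab⟩
        exact ⟨Z, a, b, hZ, by rw [hab, sub_zero]⟩ }

end

end IdealQuotient

end FullyRigid

end ExactCat

theorem mainTheorem2 {k : Type*} [Field k]
    {B : Type u} [Category.{v} B] [Preadditive B] [Linear k B] [HasFiniteBiproducts B]
    (E : ObjectProperty (ShortComplex B)) (hE : ExactCat.IsExactStructure E)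
    (hKS : ExactCat.IsKrullSchmidt B)
    (hP : ExactCat.HasEnoughProj E) (hI : ExactCat.HasEnoughInj E)
    (C K D : ObjectProperty B)
    (hCK : ExactCat.IsFullyRigid E C K) (hKD : ExactCat.IsCotorsionPair E K D) :
    ∃ _ : Abelian (ExactCat.IdealQuotient K),
      ExactCat.IsOneGorenstein (ExactCat.IdealQuotient K) ↔
        (∀ X : B,
          ExactCat.withoutSummand (ExactCat.sigma E D) (ExactCat.omega E C) X →
          ExactCat.withoutSummand (ExactCat.heartObj E C K) K X →
          ∀ (C₁ C₂ : B) (x : X ⟶ C₁) (c : C₁ ⟶ C₂), C C₁ → C C₂ →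
            ExactCat.IsConflation E x c → ExactCat.OmegaVanishes E K x) ∧
        (∀ Y : B,
          ExactCat.withoutSummand (ExactCat.omega E C) (ExactCat.sigma E D) Y →
          ExactCat.withoutSummand (ExactCat.heartObj E C K) K Y →
          ∀ (D₁ D₂ : B) (d : D₂ ⟶ D₁) (y : D₁ ⟶ Y), D D₁ → D D₂ →
            ExactCat.IsConflation E d y → ExactCat.SigmaVanishes E K y) := by
  have h := hCK.rigidTwinCotorsion hE hKS hP hI hKD
  let _ := ExactCat.idealQuotientPreadditive h
  have hQ := ExactCat.isIdealQuotientFunctor_functor h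
  have hQz : ∀ {X Y : B} (f : X ⟶ Y), (Quotient.functor (ExactCat.factorRel K)).map f = 0 ↔
      ExactCat.IsZeroInQuotient K f := fun f ↦ by
    have := hQ.additive
    rw [ExactCat.IsZeroInQuotient, Functor.map_zero]
  have := hQ.hasFiniteProducts h
  let inst : Abelian (ExactCat.IdealQuotient K) := hQ.abelian h
    (hQ.exists_coCone_iso h hE hKS.localInduction fun _ hX hK ↦ hCK.coCone_of_isLocalObj hX hK)
  refine ⟨inst, (ExactCat.isOneGorenstein_iff hQ hE hKS hP hI hCK hKD).trans ?_⟩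
  simp only [ExactCat.OmegaVanishes, ExactCat.SigmaVanishes, ← hQz]
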